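/- **Theorem 4.1.** Fix an orientation of $\mathbb R^4$ (either one). Let $\gamma_1,\gamma_2,\nu_1,\nu_2,\lambda,\mu,\beta_1,\beta_2$ be real $C^\infty$ functions on a domain (nonempty connected open set) $\mathcal D\subset\mathbb R^2$ with coordinates $(u,v)$. Write $$\sqrt E:=\frac{\mu_u}{2\mu\gamma_2+\nu_1\beta_2-\lambda\beta_1},\qquad \sqrt G:=\frac{\mu_v}{2\mu\gamma_1-\lambda\beta_2+\nu_2\beta_1},$$ and assume that on $\mathcal D$ the denominators do not vanish, $\sqrt E>0$ and $\sqrt G>0$, and $$\begin{aligned} -\gamma_1\sqrt E\sqrt G&=(\sqrt E)_v,\qquad -\gamma_2\sqrt E\sqrt G=(\sqrt G)_u,\\ \nu_1\nu_2-(\lambda^2+\mu^2)&=\tfrac1{\sqrt E}(\gamma_2)_u+\tfrac1{\sqrt G}(\gamma_1)_v-(\gamma_1^2+\gamma_2^2),\\ 2\lambda\gamma_2+\mu\beta_1-(\nu_1-\nu_2)\gamma_1&=\tfrac1{\sqrt E}\lambda_u-\tfrac1{\sqrt G}(\nu_1)_v,\\ 2\lambda\gamma_1+\mu\beta_2+(\nu_1-\nu_2)\gamma_2&=-\tfrac1{\sqrt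 E}(\nu_2)_u+\tfrac1{\sqrt G}\lambda_v,\\ \gamma_1\beta_1-\gamma_2\beta_2+(\nu_1-\nu_2)\mu&=-\tfrac1{\sqrt E}(\beta_2)_u+\tfrac1{\sqrt G}(\beta_1)_v. \end{aligned}$$ Let $(u_0,v_0)\in\mathcal D$, let $p_0\in\mathbb R^4$, and let $x_0,y_0,b_0,l_0$ be a positively oriented orthonormal frame of $\mathbb R^4$. Then there is a domain $\mathcal D_0\subset\mathcal D$ containing $(u_0,v_0)$ and a unique regular $C^\infty$ surface $z:\mathcal D_0\to\mathbb R^4$ with $z(u_0,v_0)=p_0$, parametrized by principal lines, for which there are smooth $b,l:\mathcal D_0\to\mathbb R^4$ such that $x,y,b,l$ is a geometric frame field of $z$, the eight given functions are the geometric functions of $z$ with respect to this frame field, and $(x,y,b,l)(u_0,v_0)=(x_0,y_0,b_0,l_0)$. Moreover, on $\mathcal D_0$ one has $|z_u|=\sqrt E$ and $|z_v|=\sqrt G$ with the quotients above, and a point is not minimal, i.e. $\varkappa^2-k>0$ there, if and only if $\mu\neq0$ and $\nu_1+\nu_2\ne0$ there; in particular, if $\mu(\nu_1+\nu_2)\neq0$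 on $\mathcal D$, then the surface is free of minimal points. Here, for a surface $z$: $E,F,G$ are the coefficients of its first fundamental form, $W=\sqrt{EG-F^2}$, and $\sigma$ is its second fundamental tensor (the normal component of the second derivative). With $\Delta_1,\Delta_2,\Delta_3$ the oriented areas of the parallelograms spanned by $(\sigma(z_u,z_u),\sigma(z_u,z_v))$, $(\sigma(z_u,z_u),\sigma(z_v,z_v))$, $(\sigma(z_u,z_v),\sigma(z_v,z_v))$ in the normal plane, which is oriented so that a positive basis of it, put after $z_u,z_v$, gives a positive basis of $\mathbb R^4$, set $L=2\Delta_1/W$, $M=\Delta_2/W$, $N=2\Delta_3/W$, $k=\frac{LN-M^2}{EG-F^2}$, $\varkappa=\frac{EN+GL-2FM}{2(EG-F^2)}$. The surface is parametrized by principal lines if $F=M=0$. Put $x=z_u/|z_u|$, $y=z_v/|z_v|$. A geometric frame field is a positively oriented orthonormal frame field $x,y,b,l$, with $b,l$ smooth and $\sigma(x,x),\sigma(y,y)$ collinear with $b$. The geometric functions of $z$ with respect to it are the functions given by $\gamma_1=-y(\ln|z_u|)$, $\gamma_2=-x(\ln|z_v|)$, $\sigma(x,x)=\nu_1b$, $\sigma(x,y)=\lambda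 b+\mu l$, $\sigma(y,y)=\nu_2b$, $\beta_1=\langle\nabla'_xb,l\rangle$, $\beta_2=\langle\nabla'_yb,l\rangle$, where $\nabla'$ is the flat connection of $\mathbb R^4$. -/

import Mathlib

open scoped ContDiff

noncomputable section

/-- Euclidean four-space. -/
abbrev R4 := EuclideanSpace ℝ (Fin 4)

instance instFactFinrankR4 : Fact (Module.finrank ℝ R4 = 4) := ⟨by simp⟩

/-- A domain of the parameter plane: a nonempty connected open set. -/
def IsPlaneDomain (D : Set (ℝ × ℝ)) : Prop := IsOpen D ∧ IsConnected D

section Partial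

variable {F : Type*} [NormedAddCommGroup F] [NormedSpace ℝ F]

/-- The partial derivative `f_u`, where `(u, v)` are the coordinates of the plane. -/
def partialU (f : ℝ × ℝ → F) (q : ℝ × ℝ) : F := fderiv ℝ f q (1, 0)

/-- The partial derivative `f_v`. -/
def partialV (f : ℝ × ℝ → F) (q : ℝ × ℝ) : F := fderiv ℝ f q (0, 1)

end Partial

/-- `z` is a (regular, smooth, parametrized) surface `z = z(u, v)`, `(u, v) ∈ D`, in `ℝ⁴`. -/
structure IsSurface (z : ℝ × ℝ → R4) (D : Set (ℝ × ℝ)) : Prop where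
  smooth : ContDiffOn ℝ ∞ z D
  regular : ∀ q ∈ D, LinearIndependent ℝ ![partialU z q, partialV z q]

namespace Surface

/-! First fundamental form: `E`, `F`, `G` and `W = √(EG - F²)`. -/

def coeffE (z : ℝ × ℝ → R4) (q : ℝ × ℝ) : ℝ := inner ℝ (partialU z q) (partialU z q)

def coeffF (z : ℝ × ℝ → R4) (q : ℝ × ℝ) : ℝ := inner ℝ (partialU z q) (partialV z q)

def coeffG (z : ℝ × ℝ → R4) (q : ℝ × ℝ) : ℝ := inner ℝ (partialV z q) (partialV z q)

def coeffW (z : ℝ × ℝ → R4) (q : ℝ × ℝ) : ℝ :=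
  Real.sqrt (coeffE z q * coeffG z q - coeffF z q ^ 2)

/-- The tangent plane `span {z_u, z_v}`. -/
def tangentPlane (z : ℝ × ℝ → R4) (q : ℝ × ℝ) : Submodule ℝ R4 :=
  Submodule.span ℝ {partialU z q, partialV z q}

/-- The second fundamental tensor `σ`. The arguments `X = (X₁, X₂)` and `Y = (Y₁, Y₂)` are the
coordinates of the tangent vectors `X₁ z_u + X₂ z_v` and `Y₁ z_u + Y₂ z_v`; the value is the
normal component of the second derivative of `z` in these directions. -/
def sigma (z : ℝ × ℝ → R4) (q X Y : ℝ × ℝ) : R4 :=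
  (tangentPlane z q)ᗮ.starProjection (fderiv ℝ (fun p => fderiv ℝ z p Y) q X)

/-- The oriented area of the parallelogram spanned by the normal vectors `m`, `n`; the normal
plane is oriented so that a basis `e₁`, `e₂` of it is positive if and only if
`z_u, z_v, e₁, e₂` is a positive basis of `ℝ⁴`. -/
def normalArea (o : Orientation ℝ R4 (Fin 4)) (z : ℝ × ℝ → R4) (q : ℝ × ℝ) (m n : R4) : ℝ :=
  o.volumeForm ![partialU z q, partialV z q, m, n] / coeffW z q

/-! The functions `L = 2 Δ₁ / W`, `M = Δ₂ / W`, `N = 2 Δ₃ / W`. -/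

def coeffL (o : Orientation ℝ R4 (Fin 4)) (z : ℝ × ℝ → R4) (q : ℝ × ℝ) : ℝ :=
  2 * normalArea o z q (sigma z q (1, 0) (1, 0)) (sigma z q (1, 0) (0, 1)) / coeffW z q

def coeffM (o : Orientation ℝ R4 (Fin 4)) (z : ℝ × ℝ → R4) (q : ℝ × ℝ) : ℝ :=
  normalArea o z q (sigma z q (1, 0) (1, 0)) (sigma z q (0, 1) (0, 1)) / coeffW z q

def coeffN (o : Orientation ℝ R4 (Fin 4)) (z : ℝ × ℝ → R4) (q : ℝ × ℝ) : ℝ :=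
  2 * normalArea o z q (sigma z q (1, 0) (0, 1)) (sigma z q (0, 1) (0, 1)) / coeffW z q

/-- The invariant `k = (LN - M²) / (EG - F²)`. -/
def invK (o : Orientation ℝ R4 (Fin 4)) (z : ℝ × ℝ → R4) (q : ℝ × ℝ) : ℝ :=
  (coeffL o z q * coeffN o z q - coeffM o z q ^ 2) /
    (coeffE z q * coeffG z q - coeffF z q ^ 2)

/-- The invariant `ϰ = (EN + GL - 2FM) / (2 (EG - F²))`. -/
def invKappa (o : Orientation ℝ R4 (Fin 4)) (z : ℝ × ℝ → R4) (q : ℝ × ℝ) : ℝ :=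
  (coeffE z q * coeffN o z q + coeffG z q * coeffL o z q - 2 * coeffF z q * coeffM o z q) /
    (2 * (coeffE z q * coeffG z q - coeffF z q ^ 2))

/-- The surface is parametrized by principal lines: `F = 0` and `M = 0`. -/
def IsPrincipal (o : Orientation ℝ R4 (Fin 4)) (z : ℝ × ℝ → R4) (D : Set (ℝ × ℝ)) : Prop :=
  ∀ q ∈ D, coeffF z q = 0 ∧ coeffM o z q = 0

/-- The coordinates of the unit tangent vector `x = z_u / √E`. For a function `f` of `(u, v)`,
the derivative of `f` in the direction `x` is `fderiv ℝ f q (dirX z q)`. -/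
def dirX (z : ℝ × ℝ → R4) (q : ℝ × ℝ) : ℝ × ℝ := (1 / Real.sqrt (coeffE z q), 0)

/-- The coordinates of the unit tangent vector `y = z_v / √G`. -/
def dirY (z : ℝ × ℝ → R4) (q : ℝ × ℝ) : ℝ × ℝ := (0, 1 / Real.sqrt (coeffG z q))

/-- `x = z_u / √E`. -/
def unitX (z : ℝ × ℝ → R4) (q : ℝ × ℝ) : R4 := (1 / Real.sqrt (coeffE z q)) • partialU z q

/-- `y = z_v / √G`. -/
def unitY (z : ℝ × ℝ → R4) (q : ℝ × ℝ) : R4 := (1 / Real.sqrt (coeffG z q)) • partialV z q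

/-- `x = z_u / √E`, `y = z_v / √G`, `b`, `l` is a geometric frame field of the surface: a
positively oriented orthonormal frame field with `b`, `l` smooth and with `σ(x, x)`, `σ(y, y)`
collinear with `b`. -/
structure IsGeometricFrame (o : Orientation ℝ R4 (Fin 4)) (z : ℝ × ℝ → R4) (D : Set (ℝ × ℝ))
    (b l : ℝ × ℝ → R4) : Prop where
  smooth_b : ContDiffOn ℝ ∞ b D
  smooth_l : ContDiffOn ℝ ∞ l D
  orthonormal : ∀ q ∈ D, Orthonormal ℝ ![unitX z q, unitY z q, b q, l q]
  positive : ∀ q ∈ D, 0 < o.volumeForm ![unitX z q, unitY z q, b q, l q]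
  collinear_x : ∀ q ∈ D, sigma z q (dirX z q) (dirX z q) ∈ Submodule.span ℝ {b q}
  collinear_y : ∀ q ∈ D, sigma z q (dirY z q) (dirY z q) ∈ Submodule.span ℝ {b q}

end Surface

/-- Eight functions `γ₁, γ₂, ν₁, ν₂, λ, μ, β₁, β₂` of two variables. -/
structure EightFunctions where
  γ₁ : ℝ × ℝ → ℝ
  γ₂ : ℝ × ℝ → ℝ
  ν₁ : ℝ × ℝ → ℝ
  ν₂ : ℝ × ℝ → ℝ
  lam : ℝ × ℝ → ℝ
  μ : ℝ × ℝ → ℝ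
  β₁ : ℝ × ℝ → ℝ
  β₂ : ℝ × ℝ → ℝ

namespace EightFunctions

/-- All eight functions are smooth on `D`. -/
structure Smooth (f : EightFunctions) (D : Set (ℝ × ℝ)) : Prop where
  γ₁ : ContDiffOn ℝ ∞ f.γ₁ D
  γ₂ : ContDiffOn ℝ ∞ f.γ₂ D
  ν₁ : ContDiffOn ℝ ∞ f.ν₁ D
  ν₂ : ContDiffOn ℝ ∞ f.ν₂ D
  lam : ContDiffOn ℝ ∞ f.lam D
  μ : ContDiffOn ℝ ∞ f.μ D
  β₁ : ContDiffOn ℝ ∞ f.β₁ D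
  β₂ : ContDiffOn ℝ ∞ f.β₂ D

/-- The quotient `μ_u / (2 μ γ₂ + ν₁ β₂ - λ β₁)`, denoted by `√E`. -/
def sqrtE (f : EightFunctions) (q : ℝ × ℝ) : ℝ :=
  partialU f.μ q / (2 * f.μ q * f.γ₂ q + f.ν₁ q * f.β₂ q - f.lam q * f.β₁ q)

/-- The quotient `μ_v / (2 μ γ₁ - λ β₂ + ν₂ β₁)`, denoted by `√G`. -/
def sqrtG (f : EightFunctions) (q : ℝ × ℝ) : ℝ :=
  partialV f.μ q / (2 * f.μ q * f.γ₁ q - f.lam q * f.β₂ q + f.ν₂ q * f.β₁ q)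

/-- Both quotients are positive (in particular their denominators do not vanish). -/
def Inequalities (f : EightFunctions) (D : Set (ℝ × ℝ)) : Prop :=
  ∀ q ∈ D, 0 < f.sqrtE q ∧ 0 < f.sqrtG q

/-- The compatibility equations, with `√E`, `√G` the two quotients above. -/
structure Compatible (f : EightFunctions) (D : Set (ℝ × ℝ)) : Prop where
  eq₁ : ∀ q ∈ D, -f.γ₁ q * f.sqrtE q * f.sqrtG q = partialV f.sqrtE q
  eq₂ : ∀ q ∈ D, -f.γ₂ q * f.sqrtE q * f.sqrtG q = partialU f.sqrtG q
  eq₃ : ∀ q ∈ D, f.ν₁ q * f.ν₂ q - (f.lam q ^ 2 + f.μ q ^ 2) =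
    1 / f.sqrtE q * partialU f.γ₂ q + 1 / f.sqrtG q * partialV f.γ₁ q -
      (f.γ₁ q ^ 2 + f.γ₂ q ^ 2)
  eq₄ : ∀ q ∈ D, 2 * f.lam q * f.γ₂ q + f.μ q * f.β₁ q - (f.ν₁ q - f.ν₂ q) * f.γ₁ q =
    1 / f.sqrtE q * partialU f.lam q - 1 / f.sqrtG q * partialV f.ν₁ q
  eq₅ : ∀ q ∈ D, 2 * f.lam q * f.γ₁ q + f.μ q * f.β₂ q + (f.ν₁ q - f.ν₂ q) * f.γ₂ q =
    -(1 / f.sqrtE q * partialU f.ν₂ q) + 1 / f.sqrtG q * partialV f.lam q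
  eq₆ : ∀ q ∈ D, f.γ₁ q * f.β₁ q - f.γ₂ q * f.β₂ q + (f.ν₁ q - f.ν₂ q) * f.μ q =
    -(1 / f.sqrtE q * partialU f.β₂ q) + 1 / f.sqrtG q * partialV f.β₁ q

open Surface in
/-- The eight functions are the geometric functions of the surface `z` with respect to its
geometric frame field `x, y, b, l`:
`γ₁ = -y(ln √E)`, `γ₂ = -x(ln √G)`, `σ(x,x) = ν₁ b`, `σ(x,y) = λ b + μ l`, `σ(y,y) = ν₂ b`,
and `β₁ = ⟨∇'_x b, l⟩`, `β₂ = ⟨∇'_y b, l⟩`, with `∇'` the flat connection of `ℝ⁴`. -/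
structure AreGeometricFunctions (f : EightFunctions) (z : ℝ × ℝ → R4) (D : Set (ℝ × ℝ))
    (b l : ℝ × ℝ → R4) : Prop where
  γ₁ : ∀ q ∈ D,
    f.γ₁ q = -fderiv ℝ (fun p => Real.log (Real.sqrt (coeffE z p))) q (dirY z q)
  γ₂ : ∀ q ∈ D,
    f.γ₂ q = -fderiv ℝ (fun p => Real.log (Real.sqrt (coeffG z p))) q (dirX z q)
  sigma_xx : ∀ q ∈ D, sigma z q (dirX z q) (dirX z q) = f.ν₁ q • b q
  sigma_xy : ∀ q ∈ D, sigma z q (dirX z q) (dirY z q) = f.lam q • b q + f.μ q • l q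
  sigma_yy : ∀ q ∈ D, sigma z q (dirY z q) (dirY z q) = f.ν₂ q • b q
  β₁ : ∀ q ∈ D, f.β₁ q = inner ℝ (fderiv ℝ b q (dirX z q)) (l q)
  β₂ : ∀ q ∈ D, f.β₂ q = inner ℝ (fderiv ℝ b q (dirY z q)) (l q)

end EightFunctions

open Surface in
/-- `z`, defined on `D`, is a surface parametrized by principal lines with `z(q₀) = p₀`, whose
geometric functions (for a geometric frame field) are `f` and whose geometric frame at `q₀` is
`x₀, y₀, b₀, l₀`. -/
def IsBonnetSurface (o : Orientation ℝ R4 (Fin 4)) (f : EightFunctions) (D : Set (ℝ × ℝ))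
    (q₀ : ℝ × ℝ) (p₀ x₀ y₀ b₀ l₀ : R4) (z : ℝ × ℝ → R4) : Prop :=
  IsSurface z D ∧ IsPrincipal o z D ∧ z q₀ = p₀ ∧
    ∃ b l : ℝ × ℝ → R4, IsGeometricFrame o z D b l ∧ f.AreGeometricFunctions z D b l ∧
      unitX z q₀ = x₀ ∧ unitY z q₀ = y₀ ∧ b q₀ = b₀ ∧ l q₀ = l₀

end

/-! The frame `x, y, b, l` together with the position `z` is a 5-tuple `W` of vectors of ℝ⁴, and the
derivative formulas of a surface with the given functions form a linear total system W_u = A W, W_v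
= B W, whose 5×5 matrices depend only on these functions. Such a system is locally solvable with any
initial value as soon as A_v + AB = B_u + BA.

Entry by entry (`Compatible.flat`) this flatness consists of the Gauss equation, the Codazzi
equations in the direction `b`, the Ricci equation, the symmetry z_uv = z_vu (the formulas for
(√E)_v and (√G)_u), and the Codazzi equations in the direction `l`. The last two are not among the
listed equations: they are the definitions of √E and √G as quotients, solved for μ_u and μ_v.

Existence is Frobenius' theorem (`exists_solution_connection`): integrate the system along rays from
the base point and show that the resulting function has the right derivative in every direction. The
frame block of A and B is skew, so an orthonormal initial frame stays orthonormal, and by continuity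
it stays positive. The invariants of the resulting `z` are then read off from its derivative
formulas.

For uniqueness, the lengths of z_u and z_v of a competing surface are not given in advance. Its own
Codazzi equations in the direction `l` force them to be the two quotients (`sqrt_coeff_eq`). Hence
its frame solves the same linear system with the same initial value, and two such solutions agree
along every ray.

The statement on minimal points is the identity ϰ² - k = μ²(ν₁ + ν₂)². -/

noncomputable section

/-! ### Frobenius' theorem for linear total differential equations. -/

section Frobenius

set_option maxSynthPendingDepth 3

open Set Metric

variable {E V : Type*} [NormedAddCommGroup E] [NormedSpace ℝ E]
  [NormedAddCommGroup V] [NormedSpace ℝ V]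

/-- A linear differential equation with small coefficients has a solution on the unit interval. -/
theorem exists_solution_linear_ode [CompleteSpace V] (B : ℝ → V →L[ℝ] V)
    (hB : ContinuousOn B (Icc 0 1)) (hb : ∀ t ∈ Icc (0 : ℝ) 1, ‖B t‖ ≤ 1 / 2) (x₀ : V) :
    ∃ φ : ℝ → V, φ 0 = x₀ ∧
      ∀ t ∈ Icc (0 : ℝ) 1, HasDerivWithinAt φ (B t (φ t)) (Icc 0 1) t := by
  -- In the ball of radius ‖x₀‖ about x₀ one has ‖x‖ ≤ 2‖x₀‖, so the speed is at most ‖x₀‖: the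
  -- solution cannot leave the ball before time 1.
  have hP : IsPicardLindelof (fun t x => B t x) (tmin := 0) (tmax := 1)
      ⟨0, by simp⟩ x₀ ‖x₀‖₊ 0 ‖x₀‖₊ (1 / 2) := by
    refine ⟨fun t ht => ?_, fun x _ => hB.clm_apply continuousOn_const, fun t ht x hx => ?_, ?_⟩
    · refine LipschitzWith.lipschitzOnWith ((B t).lipschitz.weaken ?_)
      exact_mod_cast hb t ht
    · have h1 : ‖x‖ ≤ ‖x₀‖ + ‖x₀‖ := by
        have := norm_sub_norm_le x x₀
        rw [mem_closedBall, dist_eq_norm] at hx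
        simp only [coe_nnnorm] at hx
        linarith
      calc ‖B t x‖ ≤ ‖B t‖ * ‖x‖ := (B t).le_opNorm x
        _ ≤ 1 / 2 * (‖x₀‖ + ‖x₀‖) := by gcongr; exact hb t ht
        _ = ‖x₀‖₊ := by simp only [coe_nnnorm]; ring
    · simp
  exact hP.exists_eq_forall_mem_Icc_hasDerivWithinAt₀

/-- Solutions of a total differential equation `dW = θ W` on a ball are determined by their value
at the centre. -/
theorem eqOn_ball_of_hasFDerivAt_connection {θ : E → E →L[ℝ] V →L[ℝ] V} {q₀ : E} {R : ℝ}
    (hθ : ContinuousOn θ (ball q₀ R)) {W₁ W₂ : E → V}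
    (h₁ : ∀ q ∈ ball q₀ R, HasFDerivAt W₁ ((θ q).flip (W₁ q)) q)
    (h₂ : ∀ q ∈ ball q₀ R, HasFDerivAt W₂ ((θ q).flip (W₂ q)) q)
    (h₀ : W₁ q₀ = W₂ q₀) : EqOn W₁ W₂ (ball q₀ R) := by
  intro q hq
  have hmem : ∀ t ∈ Icc (0 : ℝ) 1, q₀ + t • (q - q₀) ∈ ball q₀ R := by
    intro t ht
    rw [mem_ball, dist_eq_norm] at hq ⊢
    rw [add_sub_cancel_left, norm_smul, Real.norm_of_nonneg ht.1]
    exact lt_of_le_of_lt (mul_le_of_le_one_left (norm_nonneg _) ht.2) hq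
  have hline : ∀ t : ℝ, HasDerivAt (fun t : ℝ => q₀ + t • (q - q₀)) (q - q₀) t := by
    intro t
    simpa using ((hasDerivAt_id t).smul_const (q - q₀)).const_add q₀
  have hcont : ContinuousOn (fun t : ℝ => θ (q₀ + t • (q - q₀)) (q - q₀)) (Icc 0 1) := by
    refine ContinuousOn.clm_apply (hθ.comp (by fun_prop) hmem) continuousOn_const
  obtain ⟨K, hK⟩ := isCompact_Icc.exists_bound_of_continuousOn hcont
  have hd : ∀ W : E → V, (∀ q ∈ ball q₀ R, HasFDerivAt W ((θ q).flip (W q)) q) →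
      ∀ t ∈ Icc (0 : ℝ) 1, HasDerivAt (fun t : ℝ => W (q₀ + t • (q - q₀)))
        (θ (q₀ + t • (q - q₀)) (q - q₀) (W (q₀ + t • (q - q₀)))) t := by
    intro W hW t ht
    exact (hW _ (hmem t ht)).comp_hasDerivAt t (hline t)
  -- On the segment from q₀ to q both maps solve the same linear ordinary equation, with a Lipschitz
  -- constant bounded by compactness of the segment.
  have := ODE_solution_unique_of_mem_Icc_right (K := K.toNNReal) (s := fun _ => univ)
    (v := fun t x => θ (q₀ + t • (q - q₀)) (q - q₀) x) (a := 0) (b := 1)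
    (f := fun t => W₁ (q₀ + t • (q - q₀))) (g := fun t => W₂ (q₀ + t • (q - q₀)))
    (fun t ht => LipschitzWith.lipschitzOnWith
      ((ContinuousLinearMap.lipschitz _).weaken (by
        rw [← NNReal.coe_le_coe, coe_nnnorm]
        exact (hK t (Ico_subset_Icc_self ht)).trans (Real.le_coe_toNNReal K))))
    (fun t ht => (hd W₁ h₁ t ht).continuousAt.continuousWithinAt)
    (fun t ht => (hd W₁ h₁ t (Ico_subset_Icc_self ht)).hasDerivWithinAt)
    (fun _ _ => mem_univ _)
    (fun t ht => (hd W₂ h₂ t ht).continuousAt.continuousWithinAt)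
    (fun t ht => (hd W₂ h₂ t (Ico_subset_Icc_self ht)).hasDerivWithinAt)
    (fun _ _ => mem_univ _) (by simpa using h₀)
  simpa using this (right_mem_Icc.2 zero_le_one)

/-- A solution of the smooth total differential equation `dW = θ W` is smooth. -/
theorem contDiffOn_of_hasFDerivAt_connection {θ : E → E →L[ℝ] V →L[ℝ] V} {s : Set E}
    (hs : IsOpen s) (hθ : ContDiffOn ℝ ∞ θ s) {W : E → V}
    (hW : ∀ q ∈ s, HasFDerivAt W ((θ q).flip (W q)) q) : ContDiffOn ℝ ∞ W s := by
  rw [contDiffOn_infty]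
  intro n
  induction n with
  | zero =>
    rw [Nat.cast_zero, contDiffOn_zero]
    exact fun q hq => (hW q hq).continuousAt.continuousWithinAt
  | succ n ih =>
    rw [Nat.cast_succ, contDiffOn_succ_iff_fderiv_of_isOpen hs]
    refine ⟨fun q hq => (hW q hq).differentiableAt.differentiableWithinAt, by simp, ?_⟩
    -- Bootstrapping: the derivative of `W` is bilinear in θ and `W`, hence as smooth as `W` is
    -- already known to be.
    have h1 : ContDiffOn ℝ n (fun q => (θ q).flip (W q)) s := by
      refine ContDiffOn.clm_apply ?_ ih
      exact (ContinuousLinearMap.flipₗᵢ ℝ E V V).contDiff.comp_contDiffOn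
        (contDiffOn_infty.1 hθ n)
    exact h1.congr fun q hq => (hW q hq).fderiv

/-- First order expansion of the solution of the radial equation in its direction. -/
theorem norm_radial_solution_sub_le {θ : E → E →L[ℝ] V →L[ℝ] V}
    {θ' : E → E →L[ℝ] E →L[ℝ] V →L[ℝ] V} {q₀ : E} {R M M' C : ℝ} (hM : 0 ≤ M) (hM' : 0 ≤ M')
    (hC : 0 ≤ C)
    (hd : ∀ q ∈ ball q₀ R, HasFDerivAt θ (θ' q) q)
    (hMb : ∀ q ∈ ball q₀ R, ‖θ q‖ ≤ M) (hM'b : ∀ q ∈ ball q₀ R, ‖θ' q‖ ≤ M')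
    (hCb : ∀ p ∈ ball q₀ R, ∀ q ∈ ball q₀ R, ‖θ' q - θ' p‖ ≤ C * ‖q - p‖)
    (hRM : M * R ≤ 1 / 2)
    (hint : ∀ q ∈ ball q₀ R, ∀ h k w, θ' q h k w + θ q k (θ q h w) =
      θ' q k h w + θ q h (θ q k w))
    {h k : E} (hh : ‖h‖ < R) (hhk : ‖h + k‖ < R) {φ ψ : ℝ → V} {S : ℝ} (h0 : φ 0 = ψ 0)
    (hφ : ∀ t ∈ Icc (0 : ℝ) 1, HasDerivWithinAt φ (θ (q₀ + t • h) h (φ t)) (Icc 0 1) t)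
    (hψ : ∀ t ∈ Icc (0 : ℝ) 1,
      HasDerivWithinAt ψ (θ (q₀ + t • (h + k)) (h + k) (ψ t)) (Icc 0 1) t)
    (hS : ∀ t ∈ Icc (0 : ℝ) 1, ‖φ t‖ ≤ S) :
    ‖ψ 1 - φ 1 - θ (q₀ + h) k (φ 1)‖ ≤
      (M' + C * R + M * M + M' * R * M) * S * 2 * (Real.exp (1 / 2) - 1) * ‖k‖ ^ 2 := by
  have hR : 0 < R := (norm_nonneg h).trans_lt hh
  have hS0 : 0 ≤ S := (norm_nonneg _).trans (hS 0 (by simp))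
  have hmem : ∀ g : E, ‖g‖ < R → ∀ t ∈ Icc (0 : ℝ) 1, q₀ + t • g ∈ ball q₀ R := by
    intro g hg t ht
    rw [mem_ball, dist_eq_norm, add_sub_cancel_left, norm_smul, Real.norm_of_nonneg ht.1]
    exact lt_of_le_of_lt (mul_le_of_le_one_left (norm_nonneg _) ht.2) hg
  have hline : ∀ t : ℝ, HasDerivAt (fun t : ℝ => q₀ + t • h) h t := by
    intro t
    simpa using ((hasDerivAt_id t).smul_const h).const_add q₀
  -- First-order guess for the solution on the ray to h + k. The correction vanishes at t = 0, and
  -- at t = 1 it is the derivative to be established.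
  set Y : ℝ → V := fun t => φ t + t • θ (q₀ + t • h) k (φ t) with hY
  set Y' : ℝ → V := fun t => θ (q₀ + t • h) h (φ t) +
    (t • (θ' (q₀ + t • h) h k (φ t) + θ (q₀ + t • h) k (θ (q₀ + t • h) h (φ t))) +
      θ (q₀ + t • h) k (φ t)) with hY'
  have hYd : ∀ t ∈ Icc (0 : ℝ) 1, HasDerivWithinAt Y (Y' t) (Icc 0 1) t := by
    intro t ht
    have h1 : HasDerivAt (fun t : ℝ => θ (q₀ + t • h)) (θ' (q₀ + t • h) h) t :=
      (hd _ (hmem h hh t ht)).comp_hasDerivAt t (hline t)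
    have h2 : HasDerivAt (fun t : ℝ => θ (q₀ + t • h) k) (θ' (q₀ + t • h) h k) t := by
      simpa using h1.clm_apply (hasDerivAt_const t k)
    have h3 := h2.hasDerivWithinAt.clm_apply (hφ t ht)
    have h4 := (hφ t ht).add ((hasDerivWithinAt_id t (Icc (0 : ℝ) 1)).smul h3)
    exact h4.congr_deriv (by simp [hY'])
  have herr : ∀ t ∈ Icc (0 : ℝ) 1, ‖Y' t - θ (q₀ + t • (h + k)) (h + k) (Y t)‖ ≤
      (M' + C * R + M * M + M' * R * M) * S * ‖k‖ ^ 2 := by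
    intro t ht
    set p := q₀ + t • h with hp
    set p' := q₀ + t • (h + k) with hp'
    have hpm : p ∈ ball q₀ R := hmem h hh t ht
    have hpm' : p' ∈ ball q₀ R := hmem _ hhk t ht
    have hpp : p' - p = t • k := by simp [hp, hp', smul_add]
    have hseg : segment ℝ p p' ⊆ ball q₀ R := (convex_ball q₀ R).segment_subset hpm hpm'
    have htk : ‖p' - p‖ ≤ ‖k‖ := by
      rw [hpp, norm_smul, Real.norm_of_nonneg ht.1]
      exact mul_le_of_le_one_left (norm_nonneg _) ht.2
    have hρ : ‖θ p' - θ p - t • θ' p k‖ ≤ C * ‖k‖ * ‖k‖ := by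
      have h1 := (convex_segment p p').norm_image_sub_le_of_norm_hasFDerivWithin_le'
        (f := θ) (f' := θ') (φ := θ' p) (C := C * ‖k‖)
        (fun q hq => (hd q (hseg hq)).hasFDerivWithinAt)
        (fun q hq => (hCb p hpm q (hseg hq)).trans (by
          gcongr
          exact (norm_sub_le_of_mem_segment hq).trans htk))
        (left_mem_segment ℝ p p') (right_mem_segment ℝ p p')
      rw [hpp, map_smul, ← hpp] at h1
      exact h1.trans (by gcongr)
    have hδ : ‖θ p' - θ p‖ ≤ M' * ‖k‖ := by
      have h1 := (convex_ball q₀ R).norm_image_sub_le_of_norm_hasFDerivWithin_le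
        (f := θ) (f' := θ') (C := M')
        (fun q hq => (hd q hq).hasFDerivWithinAt) hM'b hpm hpm'
      exact h1.trans (by gcongr)
    -- Integrability exchanges h and k in the derivative of the correction. After that all terms of
    -- order zero and one in k cancel, and the four that remain are quadratic in k.
    have hid : Y' t - θ p' (h + k) (Y t) =
        -(t • θ' p k k (φ t)) - (θ p' - θ p - t • θ' p k) (h + k) (φ t)
          - t • θ p k (θ p k (φ t)) - t • (θ p' - θ p) (h + k) (θ p k (φ t)) := by
      have := hint p hpm h k (φ t)
      simp only [hY, hY', ← hp, this, map_add, map_smul, add_apply,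
        sub_apply, smul_apply]
      module
    have hφS := hS t ht
    have hθp := hMb p hpm
    have hθ'p := hM'b p hpm
    have ht1 : ‖t‖ ≤ 1 := by rw [Real.norm_of_nonneg ht.1]; exact ht.2
    have b1 : ‖t • θ' p k k (φ t)‖ ≤ 1 * (M' * ‖k‖ * ‖k‖ * S) := by
      rw [norm_smul]
      gcongr
      refine (ContinuousLinearMap.le_opNorm _ _).trans ?_
      gcongr
      refine (ContinuousLinearMap.le_opNorm _ _).trans ?_
      gcongr
      exact (ContinuousLinearMap.le_opNorm _ _).trans (by gcongr)
    have b2 : ‖(θ p' - θ p - t • θ' p k) (h + k) (φ t)‖ ≤ C * ‖k‖ * ‖k‖ * R * S := by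
      refine (ContinuousLinearMap.le_opNorm _ _).trans ?_
      gcongr
      exact (ContinuousLinearMap.le_opNorm _ _).trans (by gcongr)
    have bk : ∀ w, ‖θ p k w‖ ≤ M * ‖k‖ * ‖w‖ := by
      intro w
      refine (ContinuousLinearMap.le_opNorm _ _).trans ?_
      gcongr
      exact (ContinuousLinearMap.le_opNorm _ _).trans (by gcongr)
    have b3 : ‖t • θ p k (θ p k (φ t))‖ ≤ 1 * (M * ‖k‖ * (M * ‖k‖ * S)) := by
      rw [norm_smul]
      gcongr
      refine (bk _).trans ?_
      gcongr
      exact (bk _).trans (by gcongr)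
    have b4 : ‖t • (θ p' - θ p) (h + k) (θ p k (φ t))‖ ≤
        1 * (M' * ‖k‖ * R * (M * ‖k‖ * S)) := by
      rw [norm_smul]
      gcongr
      refine (ContinuousLinearMap.le_opNorm _ _).trans ?_
      gcongr
      · exact (ContinuousLinearMap.le_opNorm _ _).trans (by gcongr)
      · exact (bk _).trans (by gcongr)
    rw [hid]
    refine (norm_sub_le _ _).trans ?_
    have c1 := norm_sub_le (-(t • θ' p k k (φ t)) - (θ p' - θ p - t • θ' p k) (h + k) (φ t))
      (t • θ p k (θ p k (φ t)))
    have c2 := norm_sub_le (-(t • θ' p k k (φ t))) ((θ p' - θ p - t • θ' p k) (h + k) (φ t))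
    rw [norm_neg] at c2
    nlinarith
  have hici : ∀ {f : ℝ → V} {f' : V} {t : ℝ}, t ∈ Ico (0 : ℝ) 1 →
      HasDerivWithinAt f f' (Icc 0 1) t → HasDerivWithinAt f f' (Ici t) t := by
    intro f f' t ht hf
    exact hf.mono_of_mem_nhdsWithin (Icc_mem_nhdsGE_of_mem ht)
  -- Grönwall: `Y` solves the equation of ψ up to an error ε = O(‖k‖²) with the same initial value,
  -- so at time 1 the two differ by at most (ε / K)(exp K - 1), where K = 1/2.
  have key := dist_le_of_approx_trajectories_ODE_of_mem (K := 1 / 2) (s := fun _ => univ)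
    (v := fun t x => θ (q₀ + t • (h + k)) (h + k) x) (a := 0) (b := 1)
    (f := ψ) (g := Y) (f' := fun t => θ (q₀ + t • (h + k)) (h + k) (ψ t)) (g' := Y')
    (εf := 0) (εg := (M' + C * R + M * M + M' * R * M) * S * ‖k‖ ^ 2) (δ := 0)
    (fun t ht => LipschitzWith.lipschitzOnWith
      ((ContinuousLinearMap.lipschitz _).weaken (by
        rw [← NNReal.coe_le_coe, coe_nnnorm]
        refine (ContinuousLinearMap.le_opNorm _ _).trans ?_
        refine le_trans ?_ hRM
        gcongr
        exact hMb _ (hmem _ hhk t (Ico_subset_Icc_self ht)))))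
    (fun t ht => (hψ t ht).continuousWithinAt)
    (fun t ht => hici ht (hψ t (Ico_subset_Icc_self ht)))
    (fun t _ => by simp)
    (fun _ _ => mem_univ _)
    (fun t ht => (hYd t ht).continuousWithinAt)
    (fun t ht => hici ht (hYd t (Ico_subset_Icc_self ht)))
    (fun t ht => by rw [dist_eq_norm]; exact herr t (Ico_subset_Icc_self ht))
    (fun _ _ => mem_univ _) (by simp [hY, h0]) 1 (by simp)
  rw [gronwallBound_of_K_ne_0 (by norm_num), dist_eq_norm] at key
  have e1 : ψ 1 - Y 1 = ψ 1 - φ 1 - θ (q₀ + h) k (φ 1) := by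
    simp only [hY, one_smul]; abel
  rw [e1] at key
  refine key.trans (le_of_eq ?_)
  push_cast
  norm_num
  ring

/-- **Frobenius' theorem** for total linear differential equations `dW = θ W`. -/
theorem exists_solution_connection [CompleteSpace V] {θ : E → E →L[ℝ] V →L[ℝ] V} {D : Set E}
    (hD : IsOpen D) (hθ : ContDiffOn ℝ ∞ θ D)
    (hint : ∀ q ∈ D, ∀ h k w, fderiv ℝ θ q h k w + θ q k (θ q h w) =
      fderiv ℝ θ q k h w + θ q h (θ q k w))
    {q₀ : E} (hq₀ : q₀ ∈ D) (W₀ : V) :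
    ∃ R > 0, ball q₀ R ⊆ D ∧ ∃ W : E → V, W q₀ = W₀ ∧
      ∀ q ∈ ball q₀ R, HasFDerivAt W ((θ q).flip (W q)) q := by
  have hθd : ∀ q ∈ D, ContDiffAt ℝ ∞ θ q := fun q hq => hθ.contDiffAt (hD.mem_nhds hq)
  have hθ' : ContDiffAt ℝ 1 (fderiv ℝ θ) q₀ :=
    (hθd q₀ hq₀).fderiv_right (by norm_cast)
  obtain ⟨C, s, hs, hC⟩ := hθ'.exists_lipschitzOnWith
  have e1 : ∀ᶠ q in nhds q₀, ‖θ q‖ < ‖θ q₀‖ + 1 :=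
    (hθd q₀ hq₀).continuousAt.norm.eventually_lt_const (by linarith)
  have e2 : ∀ᶠ q in nhds q₀, ‖fderiv ℝ θ q‖ < ‖fderiv ℝ θ q₀‖ + 1 :=
    hθ'.continuousAt.norm.eventually_lt_const (by linarith)
  obtain ⟨r, hr, hrs⟩ := Metric.eventually_nhds_iff_ball.1
    (e1.and (e2.and ((hD.eventually_mem hq₀).and
      (Filter.eventually_mem_set.2 hs))))
  set M := ‖θ q₀‖ + 1 with hMdef
  have hM : 0 < M := by positivity
  -- For ‖h‖ < R ≤ 1/(2M) the radial operator θ(q₀ + th)h has norm at most 1/2, so every radial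
  -- equation is solvable up to t = 1.
  set R := min r (1 / (2 * M)) with hRdef
  have hR : 0 < R := by positivity
  have hRM : M * R ≤ 1 / 2 := by
    calc M * R ≤ M * (1 / (2 * M)) := by gcongr; exact min_le_right _ _
      _ = 1 / 2 := by field_simp
  have hball : ball q₀ R ⊆ ball q₀ r := ball_subset_ball (min_le_left _ _)
  have hsub : ball q₀ R ⊆ D := fun q hq => (hrs q (hball hq)).2.2.1
  have hmem : ∀ g : E, ‖g‖ < R → ∀ t ∈ Icc (0 : ℝ) 1, q₀ + t • g ∈ ball q₀ R := by
    intro g hg t ht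
    rw [mem_ball, dist_eq_norm, add_sub_cancel_left, norm_smul, Real.norm_of_nonneg ht.1]
    exact lt_of_le_of_lt (mul_le_of_le_one_left (norm_nonneg _) ht.2) hg
  have hsol : ∀ h : E, ∃ φ : ℝ → V, ‖h‖ < R → φ 0 = W₀ ∧
      ∀ t ∈ Icc (0 : ℝ) 1, HasDerivWithinAt φ (θ (q₀ + t • h) h (φ t)) (Icc 0 1) t := by
    intro h
    by_cases hh : ‖h‖ < R
    · obtain ⟨φ, h1, h2⟩ := exists_solution_linear_ode (fun t => θ (q₀ + t • h) h)
        (ContinuousOn.clm_apply ((hθ.continuousOn.mono hsub).comp (by fun_prop) (hmem h hh))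
          continuousOn_const)
        (fun t ht => by
          refine (ContinuousLinearMap.le_opNorm _ _).trans (le_trans ?_ hRM)
          gcongr
          exact (hrs _ (hball (hmem h hh t ht))).1.le) W₀
      exact ⟨φ, fun _ => ⟨h1, h2⟩⟩
    · exact ⟨0, fun h' => absurd h' hh⟩
  choose φ hφ using hsol
  -- The value at q is the radial solution in the direction q - q₀ at time 1. At q₀ the direction is
  -- zero, so that solution is constant.
  refine ⟨R, hR, hsub, fun q => φ (q - q₀) 1, ?_, ?_⟩
  · obtain ⟨h1, h2⟩ := hφ (q₀ - q₀) (by simpa using hR)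
    have : ∀ t ∈ Icc (0 : ℝ) 1, HasDerivWithinAt (φ (q₀ - q₀)) 0 (Icc 0 1) t := by
      intro t ht
      simpa using h2 t ht
    have := (convex_Icc (0 : ℝ) 1).norm_image_sub_le_of_norm_hasDerivWithin_le (C := 0) this
      (by simp) (left_mem_Icc.2 zero_le_one) (right_mem_Icc.2 zero_le_one)
    rw [zero_mul, norm_le_zero_iff, sub_eq_zero, h1] at this
    exact this
  · intro q hq
    set h := q - q₀ with hhdef
    have hh : ‖h‖ < R := by rwa [mem_ball, dist_eq_norm] at hq
    have hqh : q = q₀ + h := by simp [hhdef]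
    obtain ⟨S, hS⟩ := isCompact_Icc.exists_bound_of_continuousOn
      (fun t ht => ((hφ h hh).2 t ht).continuousWithinAt)
    rw [hasFDerivAt_iff_isLittleO_nhds_zero]
    refine Asymptotics.IsBigO.trans_isLittleO (g := fun k : E => ‖k‖ ^ 2) ?_ ?_
    · refine Asymptotics.IsBigO.of_bound ((‖fderiv ℝ θ q₀‖ + 1 + C * R + M * M +
        (‖fderiv ℝ θ q₀‖ + 1) * R * M) * S * 2 * (Real.exp (1 / 2) - 1)) ?_
      have : ∀ᶠ k in nhds (0 : E), ‖h + k‖ < R := by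
        have hc : ContinuousAt (fun k : E => ‖h + k‖) 0 := by fun_prop
        exact hc.eventually_lt_const (by simpa using hh)
      filter_upwards [this] with k hk
      have := norm_radial_solution_sub_le (θ := θ) (θ' := fderiv ℝ θ) (q₀ := q₀) (R := R) (M := M)
        (M' := ‖fderiv ℝ θ q₀‖ + 1) (C := C) hM.le (by positivity) C.2
        (fun p hp => ((hθd p (hsub hp)).differentiableAt (by simp)).hasFDerivAt)
        (fun p hp => (hrs p (hball hp)).1.le) (fun p hp => (hrs p (hball hp)).2.1.le)
        (fun p hp p' hp' => hC.norm_sub_le (hrs p' (hball hp')).2.2.2 (hrs p (hball hp)).2.2.2)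
        hRM (fun p hp => hint p (hsub hp)) hh hk
        ((hφ h hh).1.trans (hφ (h + k) hk).1.symm) (hφ h hh).2 (hφ (h + k) hk).2 hS
      rw [Real.norm_of_nonneg (by positivity : (0 : ℝ) ≤ ‖k‖ ^ 2)]
      have e : q + k - q₀ = h + k := by rw [hqh]; abel
      simpa only [e, ContinuousLinearMap.flip_apply, ← hhdef, ← hqh] using this
    · have := (Asymptotics.isLittleO_pow_id (𝕜 := ℝ) (n := 2) (by norm_num)).comp_tendsto
        (tendsto_norm_zero (E := E))
      exact this.norm_right.congr_right (by simp) |>.of_norm_right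

end Frobenius

end

noncomputable section

/-! ### Connections over the plane, in terms of their u- and v-components. -/

section PlaneConnection

set_option maxSynthPendingDepth 3

open Set Metric

variable {F V : Type*} [NormedAddCommGroup F] [NormedSpace ℝ F]
  [NormedAddCommGroup V] [NormedSpace ℝ V]

/-- The linear map of the plane with values `a`, `c` on the standard basis. -/
def planeMap (a c : F) : ℝ × ℝ →L[ℝ] F :=
  (ContinuousLinearMap.fst ℝ ℝ ℝ).smulRight a + (ContinuousLinearMap.snd ℝ ℝ ℝ).smulRight c

theorem planeMap_apply (a c : F) (h : ℝ × ℝ) : planeMap a c h = h.1 • a + h.2 • c := by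
  simp [planeMap]

theorem planeMap_eta (T : ℝ × ℝ →L[ℝ] F) : planeMap (T (1, 0)) (T (0, 1)) = T := by
  ext <;> simp [planeMap_apply]

theorem hasFDerivAt_planeMap {f : ℝ × ℝ → F} {q : ℝ × ℝ} {a c : F}
    (hf : DifferentiableAt ℝ f q) (ha : partialU f q = a) (hc : partialV f q = c) :
    HasFDerivAt f (planeMap a c) q := by
  subst ha hc
  rw [partialU, partialV, planeMap_eta]
  exact hf.hasFDerivAt

theorem partialU_eq_of_hasFDerivAt {f : ℝ × ℝ → F} {q : ℝ × ℝ} {a c : F}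
    (hf : HasFDerivAt f (planeMap a c) q) : partialU f q = a := by
  simp [partialU, hf.fderiv, planeMap_apply]

theorem partialV_eq_of_hasFDerivAt {f : ℝ × ℝ → F} {q : ℝ × ℝ} {a c : F}
    (hf : HasFDerivAt f (planeMap a c) q) : partialV f q = c := by
  simp [partialV, hf.fderiv, planeMap_apply]

/-- The connection form with components `A` and `B`. -/
def planeConnection (A B : ℝ × ℝ → V →L[ℝ] V) (q : ℝ × ℝ) : ℝ × ℝ →L[ℝ] V →L[ℝ] V :=
  planeMap (A q) (B q)

theorem planeConnection_flip (A B : ℝ × ℝ → V →L[ℝ] V) (q : ℝ × ℝ) (w : V) :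
    (planeConnection A B q).flip w = planeMap (A q w) (B q w) := by
  ext <;> simp [planeConnection, planeMap_apply]

theorem contDiffOn_planeConnection {A B : ℝ × ℝ → V →L[ℝ] V} {D : Set (ℝ × ℝ)}
    (hA : ContDiffOn ℝ ∞ A D) (hB : ContDiffOn ℝ ∞ B D) :
    ContDiffOn ℝ ∞ (planeConnection A B) D :=
  (contDiffOn_const.smulRight hA).add (contDiffOn_const.smulRight hB)

theorem fderiv_planeConnection {A B : ℝ × ℝ → V →L[ℝ] V} {q : ℝ × ℝ}
    (hA : ContDiffAt ℝ ∞ A q) (hB : ContDiffAt ℝ ∞ B q) (h k : ℝ × ℝ) :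
    fderiv ℝ (planeConnection A B) q h k =
      k.1 • (h.1 • partialU A q + h.2 • partialV A q) +
        k.2 • (h.1 • partialU B q + h.2 • partialV B q) := by
  have h1 : DifferentiableAt ℝ (planeConnection A B) q :=
    ((contDiffAt_const.smulRight hA).add (contDiffAt_const.smulRight hB)).differentiableAt (by simp)
  replace hA := hA.differentiableAt (by simp)
  replace hB := hB.differentiableAt (by simp)
  have h2 : fderiv ℝ (fun p => planeConnection A B p k) q h =
      fderiv ℝ (planeConnection A B) q h k := by
    rw [fderiv_clm_apply h1 (differentiableAt_const k)]
    simp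
  rw [← h2]
  simp only [planeConnection, planeMap_apply]
  rw [fderiv_fun_add (by fun_prop) (by fun_prop), fderiv_fun_const_smul hA,
    fderiv_fun_const_smul hB]
  simp only [add_apply, smul_apply, partialU, partialV]
  rw [← planeMap_apply (fderiv ℝ A q (1, 0)) _ h, ← planeMap_apply (fderiv ℝ B q (1, 0)) _ h,
    planeMap_eta, planeMap_eta]

/-- Local solvability of `W_u = A W`, `W_v = B W` for a flat connection. -/
theorem exists_solution_of_flat [CompleteSpace V] {A B : ℝ × ℝ → V →L[ℝ] V} {D : Set (ℝ × ℝ)}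
    (hD : IsOpen D) (hA : ContDiffOn ℝ ∞ A D) (hB : ContDiffOn ℝ ∞ B D)
    (hflat : ∀ q ∈ D, ∀ w, partialV A q w + A q (B q w) = partialU B q w + B q (A q w))
    {q₀ : ℝ × ℝ} (hq₀ : q₀ ∈ D) (W₀ : V) :
    ∃ R > 0, ball q₀ R ⊆ D ∧ ∃ W : ℝ × ℝ → V, W q₀ = W₀ ∧ ContDiffOn ℝ ∞ W (ball q₀ R) ∧
      ∀ q ∈ ball q₀ R, HasFDerivAt W (planeMap (A q (W q)) (B q (W q))) q := by
  have hθ := contDiffOn_planeConnection hA hB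
  obtain ⟨R, hR, hsub, W, hW₀, hW⟩ := exists_solution_connection hD hθ (fun q hq h k w => by
    have hA' := hA.contDiffAt (hD.mem_nhds hq)
    have hB' := hB.contDiffAt (hD.mem_nhds hq)
    rw [fderiv_planeConnection hA' hB', fderiv_planeConnection hA' hB']
    have := hflat q hq w
    simp only [planeConnection, planeMap_apply, add_apply, smul_apply, map_add, map_smul]
    -- The curvature is alternating in (h, k), so in the plane it is its (u, v)-value times a
    -- determinant of h and k.
    have e := congrArg (fun v => (k.1 * h.2 - k.2 * h.1) • v) this
    simp only [smul_add] at e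
    rw [← sub_eq_zero] at e ⊢
    rw [← e]
    module) hq₀ W₀
  refine ⟨R, hR, hsub, W, hW₀, contDiffOn_of_hasFDerivAt_connection isOpen_ball (hθ.mono hsub) hW,
    fun q hq => ?_⟩
  rw [← planeConnection_flip]
  exact hW q hq

theorem eqOn_ball_of_hasFDerivAt_planeMap {A B : ℝ × ℝ → V →L[ℝ] V} {q₀ : ℝ × ℝ} {R : ℝ}
    (hA : ContDiffOn ℝ ∞ A (ball q₀ R)) (hB : ContDiffOn ℝ ∞ B (ball q₀ R))
    {W₁ W₂ : ℝ × ℝ → V}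
    (h₁ : ∀ q ∈ ball q₀ R, HasFDerivAt W₁ (planeMap (A q (W₁ q)) (B q (W₁ q))) q)
    (h₂ : ∀ q ∈ ball q₀ R, HasFDerivAt W₂ (planeMap (A q (W₂ q)) (B q (W₂ q))) q)
    (h₀ : W₁ q₀ = W₂ q₀) : EqOn W₁ W₂ (ball q₀ R) := by
  refine eqOn_ball_of_hasFDerivAt_connection (contDiffOn_planeConnection hA hB).continuousOn
    (fun q hq => ?_) (fun q hq => ?_) h₀
  · rw [planeConnection_flip]; exact h₁ q hq
  · rw [planeConnection_flip]; exact h₂ q hq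

end PlaneConnection

/-! ### Matrices of numbers acting on tuples of vectors. -/

section MatrixAction

variable {n : ℕ} {V : Type*} [NormedAddCommGroup V] [NormedSpace ℝ V]

/-- A matrix of numbers acts on the tuples of vectors. -/
def tupleAction (A : Fin n → Fin n → ℝ) : (Fin n → V) →L[ℝ] (Fin n → V) :=
  ContinuousLinearMap.pi fun i => ∑ j, A i j • ContinuousLinearMap.proj j

theorem tupleAction_apply (A : Fin n → Fin n → ℝ) (w : Fin n → V) (i : Fin n) :
    tupleAction A w i = ∑ j, A i j • w j := by
  simp [tupleAction]

/-- The action of matrices on tuples as a linear map. -/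
def tupleActionL (n : ℕ) (V : Type*) [NormedAddCommGroup V] [NormedSpace ℝ V] :
    (Fin n → Fin n → ℝ) →L[ℝ] (Fin n → V) →L[ℝ] (Fin n → V) :=
  LinearMap.toContinuousLinearMap
    { toFun := tupleAction
      map_add' := fun A B => by
        ext w i
        simp [tupleAction_apply, add_smul, Finset.sum_add_distrib]
      map_smul' := fun c A => by
        ext w i
        simp [tupleAction_apply, mul_smul, Finset.smul_sum] }

theorem tupleActionL_apply (A : Fin n → Fin n → ℝ) (w : Fin n → V) (i : Fin n) :
    tupleActionL n V A w i = ∑ j, A i j • w j :=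
  tupleAction_apply A w i

theorem tupleActionL_comp (A B : Fin n → Fin n → ℝ) (w : Fin n → V) (i : Fin n) :
    tupleActionL n V A (tupleActionL n V B w) i = ∑ j, (∑ k, A i k * B k j) • w j := by
  simp only [tupleActionL_apply, Finset.smul_sum, Finset.sum_smul, mul_smul]
  exact Finset.sum_comm

theorem fderiv_tupleActionL_apply {A : ℝ × ℝ → Fin n → Fin n → ℝ} {q : ℝ × ℝ}
    (hA : DifferentiableAt ℝ A q) (h : ℝ × ℝ) (w : Fin n → V) (i : Fin n) :
    fderiv ℝ (fun p => tupleActionL n V (A p)) q h w i =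
      ∑ j, fderiv ℝ (fun p => A p i j) q h • w j := by
  have h1 : fderiv ℝ (fun p => tupleActionL n V (A p)) q h = tupleActionL n V (fderiv ℝ A q h) := by
    have := ((tupleActionL n V).hasFDerivAt.comp q hA.hasFDerivAt).fderiv
    simp only [Function.comp_def] at this
    rw [this]; rfl
  have h2 : ∀ i j, fderiv ℝ (fun p => A p i j) q h = fderiv ℝ A q h i j := by
    intro i j
    have := (hasFDerivAt_pi'.1 ((hasFDerivAt_pi'.1 hA.hasFDerivAt) i) j).fderiv
    rw [this]; rfl
  rw [h1, tupleActionL_apply]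
  simp only [h2]

/-- Composition of the actions is matrix multiplication, so flatness of the operator connection
reduces to identities between real functions. -/
theorem tupleActionL_flat {A B : ℝ × ℝ → Fin n → Fin n → ℝ} {q : ℝ × ℝ}
    (hA : DifferentiableAt ℝ A q) (hB : DifferentiableAt ℝ B q)
    (hflat : ∀ i j, partialV (fun p => A p i j) q + ∑ k, A q i k * B q k j =
      partialU (fun p => B p i j) q + ∑ k, B q i k * A q k j) (w : Fin n → V) :
    partialV (fun p => tupleActionL n V (A p)) q w +
        tupleActionL n V (A q) (tupleActionL n V (B q) w) =
      partialU (fun p => tupleActionL n V (B p)) q w +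
        tupleActionL n V (B q) (tupleActionL n V (A q) w) := by
  ext1 i
  simp only [Pi.add_apply, partialU, partialV, fderiv_tupleActionL_apply hA,
    fderiv_tupleActionL_apply hB, tupleActionL_comp, ← Finset.sum_add_distrib, ← add_smul]
  exact Finset.sum_congr rfl fun j _ => by rw [← partialU, ← hflat, partialV]

end MatrixAction

/-! ### The linear system of the eight functions and its flatness. -/

namespace EightFunctions

variable {f : EightFunctions} {D : Set (ℝ × ℝ)} {q : ℝ × ℝ}

/-- The matrix of the derivative formulas of the frame and the position in the direction `u`. -/
def frameMatrixU (f : EightFunctions) (q : ℝ × ℝ) : Fin 5 → Fin 5 → ℝ :=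
  ![![0, f.sqrtE q * f.γ₁ q, f.sqrtE q * f.ν₁ q, 0, 0],
    ![-(f.sqrtE q * f.γ₁ q), 0, f.sqrtE q * f.lam q, f.sqrtE q * f.μ q, 0],
    ![-(f.sqrtE q * f.ν₁ q), -(f.sqrtE q * f.lam q), 0, f.sqrtE q * f.β₁ q, 0],
    ![0, -(f.sqrtE q * f.μ q), -(f.sqrtE q * f.β₁ q), 0, 0],
    ![f.sqrtE q, 0, 0, 0, 0]]

/-- The matrix of the derivative formulas of the frame and the position in the direction `v`. -/
def frameMatrixV (f : EightFunctions) (q : ℝ × ℝ) : Fin 5 → Fin 5 → ℝ :=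
  ![![0, -(f.sqrtG q * f.γ₂ q), f.sqrtG q * f.lam q, f.sqrtG q * f.μ q, 0],
    ![f.sqrtG q * f.γ₂ q, 0, f.sqrtG q * f.ν₂ q, 0, 0],
    ![-(f.sqrtG q * f.lam q), -(f.sqrtG q * f.ν₂ q), 0, f.sqrtG q * f.β₂ q, 0],
    ![-(f.sqrtG q * f.μ q), 0, -(f.sqrtG q * f.β₂ q), 0, 0],
    ![0, f.sqrtG q, 0, 0, 0]]

theorem contDiffOn_partial {F : Type*} [NormedAddCommGroup F] [NormedSpace ℝ F] {g : ℝ × ℝ → F}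
    (hD : IsOpen D) (hg : ContDiffOn ℝ ∞ g D) (h : ℝ × ℝ) :
    ContDiffOn ℝ ∞ (fun p => fderiv ℝ g p h) D :=
  (hg.fderiv_of_isOpen hD (by simp)).clm_apply contDiffOn_const

/-- A quotient with denominator zero has the value zero here, which positivity excludes. -/
theorem Inequalities.denU_ne_zero (hi : f.Inequalities D) (hq : q ∈ D) :
    2 * f.μ q * f.γ₂ q + f.ν₁ q * f.β₂ q - f.lam q * f.β₁ q ≠ 0 := fun h => by
  have := (hi q hq).1
  simp [sqrtE, h] at this

theorem Inequalities.denV_ne_zero (hi : f.Inequalities D) (hq : q ∈ D) :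
    2 * f.μ q * f.γ₁ q - f.lam q * f.β₂ q + f.ν₂ q * f.β₁ q ≠ 0 := fun h => by
  have := (hi q hq).2
  simp [sqrtG, h] at this

/-- In this form the definition of √E is a Codazzi equation, the `l`-component of x_uv = x_vu.
Likewise √G below encodes the `l`-component of y_uv = y_vu. -/
theorem Inequalities.partialU_μ (hi : f.Inequalities D) (hq : q ∈ D) :
    partialU f.μ q =
      f.sqrtE q * (2 * f.μ q * f.γ₂ q + f.ν₁ q * f.β₂ q - f.lam q * f.β₁ q) := by
  rw [sqrtE, div_mul_cancel₀ _ (hi.denU_ne_zero hq)]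

theorem Inequalities.partialV_μ (hi : f.Inequalities D) (hq : q ∈ D) :
    partialV f.μ q =
      f.sqrtG q * (2 * f.μ q * f.γ₁ q - f.lam q * f.β₂ q + f.ν₂ q * f.β₁ q) := by
  rw [sqrtG, div_mul_cancel₀ _ (hi.denV_ne_zero hq)]

theorem Smooth.sqrtE (hf : f.Smooth D) (hD : IsOpen D) (hi : f.Inequalities D) :
    ContDiffOn ℝ ∞ f.sqrtE D :=
  (contDiffOn_partial hD hf.μ (1, 0)).div
    ((((contDiffOn_const.mul hf.μ).mul hf.γ₂).add (hf.ν₁.mul hf.β₂)).sub (hf.lam.mul hf.β₁))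
    fun _ hq => hi.denU_ne_zero hq

theorem Smooth.sqrtG (hf : f.Smooth D) (hD : IsOpen D) (hi : f.Inequalities D) :
    ContDiffOn ℝ ∞ f.sqrtG D :=
  (contDiffOn_partial hD hf.μ (0, 1)).div
    ((((contDiffOn_const.mul hf.μ).mul hf.γ₁).sub (hf.lam.mul hf.β₂)).add (hf.ν₂.mul hf.β₁))
    fun _ hq => hi.denV_ne_zero hq

theorem Smooth.frameMatrixU (hf : f.Smooth D) (hD : IsOpen D) (hi : f.Inequalities D) :
    ContDiffOn ℝ ∞ f.frameMatrixU D := by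
  have hE := hf.sqrtE hD hi
  have h1 := hE.mul hf.γ₁
  have h2 := hE.mul hf.ν₁
  have h3 := hE.mul hf.lam
  have h4 := hE.mul hf.μ
  have h5 := hE.mul hf.β₁
  have h0 : ContDiffOn ℝ ∞ (fun _ : ℝ × ℝ => (0 : ℝ)) D := contDiffOn_const
  refine contDiffOn_pi.2 fun i => contDiffOn_pi.2 fun j => ?_
  fin_cases i <;> fin_cases j <;>
    first
    | exact h0 | exact h1 | exact h2 | exact h3 | exact h4 | exact h5 | exact hE
    | exact h1.neg | exact h2.neg | exact h3.neg | exact h4.neg | exact h5.neg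

theorem Smooth.frameMatrixV (hf : f.Smooth D) (hD : IsOpen D) (hi : f.Inequalities D) :
    ContDiffOn ℝ ∞ f.frameMatrixV D := by
  have hG := hf.sqrtG hD hi
  have h1 := hG.mul hf.γ₂
  have h2 := hG.mul hf.ν₂
  have h3 := hG.mul hf.lam
  have h4 := hG.mul hf.μ
  have h5 := hG.mul hf.β₂
  have h0 : ContDiffOn ℝ ∞ (fun _ : ℝ × ℝ => (0 : ℝ)) D := contDiffOn_const
  refine contDiffOn_pi.2 fun i => contDiffOn_pi.2 fun j => ?_
  fin_cases i <;> fin_cases j <;>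
    first
    | exact h0 | exact h1 | exact h2 | exact h3 | exact h4 | exact h5 | exact hG
    | exact h1.neg | exact h2.neg | exact h3.neg | exact h4.neg | exact h5.neg

/-- The entries of the connection matrices carry the factors √E and √G. Multiplied by √E√G, the
Gauss equation and the three after it become the polynomial identities to which flatness reduces. -/
theorem Compatible.gauss (hc : f.Compatible D) (hi : f.Inequalities D) (hq : q ∈ D) :
    f.sqrtE q * f.sqrtG q * (f.ν₁ q * f.ν₂ q - (f.lam q ^ 2 + f.μ q ^ 2)) =
      f.sqrtG q * partialU f.γ₂ q + f.sqrtE q * partialV f.γ₁ q -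
        f.sqrtE q * f.sqrtG q * (f.γ₁ q ^ 2 + f.γ₂ q ^ 2) := by
  have hE := (hi q hq).1.ne'
  have hG := (hi q hq).2.ne'
  rw [hc.eq₃ q hq]
  field_simp

theorem Compatible.codazziX (hc : f.Compatible D) (hi : f.Inequalities D) (hq : q ∈ D) :
    f.sqrtE q * f.sqrtG q *
        (2 * f.lam q * f.γ₂ q + f.μ q * f.β₁ q - (f.ν₁ q - f.ν₂ q) * f.γ₁ q) =
      f.sqrtG q * partialU f.lam q - f.sqrtE q * partialV f.ν₁ q := by
  have hE := (hi q hq).1.ne'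
  have hG := (hi q hq).2.ne'
  rw [hc.eq₄ q hq]
  field_simp

theorem Compatible.codazziY (hc : f.Compatible D) (hi : f.Inequalities D) (hq : q ∈ D) :
    f.sqrtE q * f.sqrtG q *
        (2 * f.lam q * f.γ₁ q + f.μ q * f.β₂ q + (f.ν₁ q - f.ν₂ q) * f.γ₂ q) =
      -(f.sqrtG q * partialU f.ν₂ q) + f.sqrtE q * partialV f.lam q := by
  have hE := (hi q hq).1.ne'
  have hG := (hi q hq).2.ne'
  rw [hc.eq₅ q hq]
  field_simp

theorem Compatible.ricci (hc : f.Compatible D) (hi : f.Inequalities D) (hq : q ∈ D) :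
    f.sqrtE q * f.sqrtG q *
        (f.γ₁ q * f.β₁ q - f.γ₂ q * f.β₂ q + (f.ν₁ q - f.ν₂ q) * f.μ q) =
      -(f.sqrtG q * partialU f.β₂ q) + f.sqrtE q * partialV f.β₁ q := by
  have hE := (hi q hq).1.ne'
  have hG := (hi q hq).2.ne'
  rw [hc.eq₆ q hq]
  field_simp

theorem partialU_mul {a c : ℝ × ℝ → ℝ} (ha : DifferentiableAt ℝ a q)
    (hc : DifferentiableAt ℝ c q) :
    partialU (fun p => a p * c p) q = partialU a q * c q + a q * partialU c q := by
  simp only [partialU, fderiv_fun_mul ha hc, add_apply, smul_apply, smul_eq_mul]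
  ring

theorem partialV_mul {a c : ℝ × ℝ → ℝ} (ha : DifferentiableAt ℝ a q)
    (hc : DifferentiableAt ℝ c q) :
    partialV (fun p => a p * c p) q = partialV a q * c q + a q * partialV c q := by
  simp only [partialV, fderiv_fun_mul ha hc, add_apply, smul_apply, smul_eq_mul]
  ring

theorem partialU_neg (a : ℝ × ℝ → ℝ) : partialU (fun p => -a p) q = -partialU a q := by
  simp [partialU, fderiv_fun_neg]

theorem partialV_neg (a : ℝ × ℝ → ℝ) : partialV (fun p => -a p) q = -partialV a q := by
  simp [partialV, fderiv_fun_neg]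

/-- The compatibility equations say that the connection of the frame is flat. -/
theorem Compatible.flat (hc : f.Compatible D) (hf : f.Smooth D) (hD : IsOpen D)
    (hi : f.Inequalities D) (hq : q ∈ D) (i j : Fin 5) :
    partialV (fun p => f.frameMatrixU p i j) q + ∑ k, f.frameMatrixU q i k * f.frameMatrixV q k j =
      partialU (fun p => f.frameMatrixV p i j) q +
        ∑ k, f.frameMatrixV q i k * f.frameMatrixU q k j := by
  have d : ∀ {g : ℝ × ℝ → ℝ}, ContDiffOn ℝ ∞ g D → DifferentiableAt ℝ g q := fun hg =>
    (hg.contDiffAt (hD.mem_nhds hq)).differentiableAt (by simp)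
  have hE := d (hf.sqrtE hD hi)
  have hG := d (hf.sqrtG hD hi)
  have h1 := hc.gauss hi hq
  have h2 := hc.codazziX hi hq
  have h3 := hc.codazziY hi hq
  have h4 := hc.ricci hi hq
  have e1 := (hc.eq₁ q hq).symm
  have e2 := (hc.eq₂ q hq).symm
  have m1 := hi.partialU_μ hq
  have m2 := hi.partialV_μ hq
  have c0 : partialU (fun _ : ℝ × ℝ => (0 : ℝ)) q = 0 := by simp [partialU]
  have c0' : partialV (fun _ : ℝ × ℝ => (0 : ℝ)) q = 0 := by simp [partialV]
  -- Up to sign, the frame block contributes six equations: (x, y) is Gauss, (x, b) and (y, b) are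
  -- Codazzi, (b, l) is Ricci, while (x, l) and (y, l) hold on substituting `m1` and `m2`. The last
  -- row is z_uv = z_vu, which follows from `e1` and `e2`.
  fin_cases i <;> fin_cases j <;>
    simp [frameMatrixU, frameMatrixV, Fin.sum_univ_five, partialU_neg, partialV_neg, c0, c0',
      partialU_mul hG (d hf.γ₂), partialU_mul hG (d hf.ν₂), partialU_mul hG (d hf.lam),
      partialU_mul hG (d hf.μ), partialU_mul hG (d hf.β₂),
      partialV_mul hE (d hf.γ₁), partialV_mul hE (d hf.ν₁), partialV_mul hE (d hf.lam),
      partialV_mul hE (d hf.μ), partialV_mul hE (d hf.β₁), e1, e2, m1, m2]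
  all_goals
    first
    | ring1
    | linear_combination h1 | linear_combination -h1
    | linear_combination h2 | linear_combination -h2
    | linear_combination h3 | linear_combination -h3
    | linear_combination h4 | linear_combination -h4

end EightFunctions

end

noncomputable section

/-! ### Orthonormal frames of ℝ⁴ and their inner products. -/

section Orthonormal

theorem orthonormal_four_iff {x y b l : R4} : Orthonormal ℝ ![x, y, b, l] ↔
    (inner ℝ x x = 1 ∧ inner ℝ y y = 1 ∧ inner ℝ b b = 1 ∧ inner ℝ l l = 1) ∧
    inner ℝ x y = 0 ∧ inner ℝ x b = 0 ∧ inner ℝ x l = 0 ∧ inner ℝ y b = 0 ∧ inner ℝ y l = 0 ∧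
      inner ℝ b l = 0 := by
  rw [orthonormal_iff_ite]
  constructor
  · intro h
    have h00 := h 0 0
    have h11 := h 1 1
    have h22 := h 2 2
    have h33 := h 3 3
    have h01 := h 0 1
    have h02 := h 0 2
    have h03 := h 0 3
    have h12 := h 1 2
    have h13 := h 1 3
    have h23 := h 2 3
    simp at h00 h11 h22 h33 h01 h02 h03 h12 h13 h23
    simp [*]
  · rintro ⟨⟨h0, h1, h2, h3⟩, h01, h02, h03, h12, h13, h23⟩ i j
    have h10 := real_inner_comm x y
    have h20 := real_inner_comm x b
    have h30 := real_inner_comm x l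
    have h21 := real_inner_comm y b
    have h31 := real_inner_comm y l
    have h32 := real_inner_comm b l
    fin_cases i <;> fin_cases j <;> simp_all

/-- A vector is determined by its products with an orthonormal frame. -/
theorem ext_inner_frame {x y b l v w : R4} (h : Orthonormal ℝ ![x, y, b, l])
    (hx : inner ℝ x v = inner ℝ x w) (hy : inner ℝ y v = inner ℝ y w)
    (hb : inner ℝ b v = inner ℝ b w) (hl : inner ℝ l v = inner ℝ l w) : v = w := by
  have hc : Fintype.card (Fin 4) = Module.finrank ℝ R4 := by simp
  let B := basisOfOrthonormalOfCardEqFinrank h hc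
  refine InnerProductSpace.ext_inner_left_basis B fun i => ?_
  simp only [B, coe_basisOfOrthonormalOfCardEqFinrank]
  fin_cases i <;> simpa

end Orthonormal

/-! ### Calculus of vector fields on open sets of the plane. -/

section Derivatives

variable {F : Type*} [NormedAddCommGroup F] [NormedSpace ℝ F] {D : Set (ℝ × ℝ)} {q : ℝ × ℝ}

theorem fderiv_congr_of_isOpen (hD : IsOpen D) (hq : q ∈ D) {f g : ℝ × ℝ → F}
    (h : ∀ p ∈ D, f p = g p) : fderiv ℝ f q = fderiv ℝ g q :=
  Filter.EventuallyEq.fderiv_eq (Filter.eventuallyEq_of_mem (hD.mem_nhds hq) h)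

/-- Second derivatives of a smooth map commute. -/
theorem fderiv_fderiv_comm (hD : IsOpen D) (hq : q ∈ D) {f : ℝ × ℝ → F}
    (hf : ContDiffOn ℝ ∞ f D) (X Y : ℝ × ℝ) :
    fderiv ℝ (fun p => fderiv ℝ f p Y) q X = fderiv ℝ (fun p => fderiv ℝ f p X) q Y := by
  have h1 := hf.contDiffAt (hD.mem_nhds hq)
  have h2 : DifferentiableAt ℝ (fderiv ℝ f) q :=
    (h1.fderiv_right (m := 1) (by norm_cast)).differentiableAt (by simp)
  rw [fderiv_clm_apply h2 (differentiableAt_const _), fderiv_clm_apply h2 (differentiableAt_const _)]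
  simpa using (h1.isSymmSndFDerivAt (by simpa using ENat.LEInfty.out)) X Y

/-- Leibniz rule. Applied to the products of an orthonormal frame, it gives the skew symmetry of the
derivative formulas. -/
theorem inner_fderiv_add_of_const (hD : IsOpen D) (hq : q ∈ D) {v w : ℝ × ℝ → R4} {c : ℝ}
    (hv : DifferentiableAt ℝ v q) (hw : DifferentiableAt ℝ w q)
    (h : ∀ p ∈ D, inner ℝ (v p) (w p) = c) (X : ℝ × ℝ) :
    inner ℝ (v q) (fderiv ℝ w q X) + inner ℝ (w q) (fderiv ℝ v q X) = 0 := by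
  rw [real_inner_comm _ (w q), ← fderiv_inner_apply ℝ hv hw, fderiv_congr_of_isOpen hD hq h]
  simp

theorem fderiv_smul_dir {s : ℝ × ℝ → ℝ} {v : ℝ × ℝ → F} (hs : DifferentiableAt ℝ s q)
    (hv : DifferentiableAt ℝ v q) (X : ℝ × ℝ) :
    fderiv ℝ (fun p => s p • v p) q X = s q • fderiv ℝ v q X + fderiv ℝ s q X • v q := by
  rw [fderiv_fun_smul hs hv]
  simp

end Derivatives

/-! ### The second fundamental tensor in coordinates. -/

namespace Surface

variable {z : ℝ × ℝ → R4} {D : Set (ℝ × ℝ)} {q : ℝ × ℝ}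

theorem differentiableAt_partial (hD : IsOpen D) (hq : q ∈ D) (hz : ContDiffOn ℝ ∞ z D)
    (Y : ℝ × ℝ) : DifferentiableAt ℝ (fun p => fderiv ℝ z p Y) q :=
  ((EightFunctions.contDiffOn_partial hD hz Y).contDiffAt (hD.mem_nhds hq)).differentiableAt
    (by simp)

theorem sigma_smul (hD : IsOpen D) (hq : q ∈ D) (hz : ContDiffOn ℝ ∞ z D) (a c : ℝ)
    (X Y : ℝ × ℝ) : sigma z q (a • X) (c • Y) = (a * c) • sigma z q X Y := by
  simp only [sigma, map_smul]
  rw [fderiv_fun_const_smul (differentiableAt_partial hD hq hz Y)]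
  simp [smul_smul]

theorem dirX_eq (z : ℝ × ℝ → R4) (q : ℝ × ℝ) :
    dirX z q = (1 / Real.sqrt (coeffE z q)) • ((1, 0) : ℝ × ℝ) := by simp [dirX]

theorem dirY_eq (z : ℝ × ℝ → R4) (q : ℝ × ℝ) :
    dirY z q = (1 / Real.sqrt (coeffG z q)) • ((0, 1) : ℝ × ℝ) := by simp [dirY]

theorem mem_tangentPlane_orthogonal {n : R4} :
    n ∈ (tangentPlane z q)ᗮ ↔ inner ℝ (partialU z q) n = 0 ∧ inner ℝ (partialV z q) n = 0 := by
  rw [tangentPlane, Submodule.mem_orthogonal]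
  constructor
  · intro h
    exact ⟨h _ (Submodule.subset_span (by simp)), h _ (Submodule.subset_span (by simp))⟩
  · rintro ⟨h1, h2⟩ u hu
    obtain ⟨a, c, rfl⟩ := Submodule.mem_span_pair.1 hu
    simp [inner_add_left, inner_smul_left, h1, h2]

/-- The normal projection is self-adjoint and fixes `n`, so normal components of σ are those of the
plain second derivative. -/
theorem inner_sigma {n : R4} (h : n ∈ (tangentPlane z q)ᗮ) (X Y : ℝ × ℝ) :
    inner ℝ n (sigma z q X Y) = inner ℝ n (fderiv ℝ (fun p => fderiv ℝ z p Y) q X) := by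
  rw [sigma, ← Submodule.inner_starProjection_left_eq_right,
    Submodule.starProjection_eq_self_iff.2 h]

theorem contDiffOn_inner_self_sqrt (hD : IsOpen D) (hz : ContDiffOn ℝ ∞ z D) (X : ℝ × ℝ)
    (h : ∀ q ∈ D, fderiv ℝ z q X ≠ 0) :
    ContDiffOn ℝ ∞ (fun q => Real.sqrt (inner ℝ (fderiv ℝ z q X) (fderiv ℝ z q X))) D := by
  have h1 := EightFunctions.contDiffOn_partial hD hz X
  refine (h1.inner ℝ h1).sqrt fun q hq => ?_
  exact inner_self_ne_zero.2 (h q hq)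

end Surface

/-! ### From a surface to the linear system: derivative formulas and lengths. -/

open Surface

/-- The derivative formulas of the geometric frame field of a surface. -/
structure StructureEquations (f : EightFunctions) (e g : ℝ) (x y b l : ℝ × ℝ → R4)
    (q : ℝ × ℝ) : Prop where
  x_u : partialU x q = e • (f.γ₁ q • y q + f.ν₁ q • b q)
  y_u : partialU y q = e • (-f.γ₁ q • x q + f.lam q • b q + f.μ q • l q)
  b_u : partialU b q = e • (-f.ν₁ q • x q - f.lam q • y q + f.β₁ q • l q)
  l_u : partialU l q = e • (-f.μ q • y q - f.β₁ q • b q)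
  x_v : partialV x q = g • (-f.γ₂ q • y q + f.lam q • b q + f.μ q • l q)
  y_v : partialV y q = g • (f.γ₂ q • x q + f.ν₂ q • b q)
  b_v : partialV b q = g • (-f.lam q • x q - f.ν₂ q • y q + f.β₂ q • l q)
  l_v : partialV l q = g • (-f.μ q • x q - f.β₂ q • b q)

variable {o : Orientation ℝ R4 (Fin 4)} {f : EightFunctions} {z b l : ℝ × ℝ → R4}
  {D : Set (ℝ × ℝ)} {q : ℝ × ℝ}

theorem IsSurface.partialU_ne_zero (hz : IsSurface z D) (hq : q ∈ D) : partialU z q ≠ 0 := by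
  simpa using (hz.regular q hq).ne_zero 0

theorem IsSurface.partialV_ne_zero (hz : IsSurface z D) (hq : q ∈ D) : partialV z q ≠ 0 := by
  simpa using (hz.regular q hq).ne_zero 1

theorem IsSurface.sqrt_coeffE_pos (hz : IsSurface z D) (hq : q ∈ D) :
    0 < Real.sqrt (coeffE z q) :=
  Real.sqrt_pos.2 (real_inner_self_pos.2 (hz.partialU_ne_zero hq))

theorem IsSurface.sqrt_coeffG_pos (hz : IsSurface z D) (hq : q ∈ D) :
    0 < Real.sqrt (coeffG z q) :=
  Real.sqrt_pos.2 (real_inner_self_pos.2 (hz.partialV_ne_zero hq))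

theorem IsSurface.contDiffOn_sqrt_coeffE (hz : IsSurface z D) (hD : IsOpen D) :
    ContDiffOn ℝ ∞ (fun q => Real.sqrt (coeffE z q)) D :=
  contDiffOn_inner_self_sqrt hD hz.smooth (1, 0) fun _ hq => hz.partialU_ne_zero hq

theorem IsSurface.contDiffOn_sqrt_coeffG (hz : IsSurface z D) (hD : IsOpen D) :
    ContDiffOn ℝ ∞ (fun q => Real.sqrt (coeffG z q)) D :=
  contDiffOn_inner_self_sqrt hD hz.smooth (0, 1) fun _ hq => hz.partialV_ne_zero hq

theorem IsSurface.contDiffOn_unitX (hz : IsSurface z D) (hD : IsOpen D) :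
    ContDiffOn ℝ ∞ (unitX z) D :=
  (contDiffOn_const.div (hz.contDiffOn_sqrt_coeffE hD) fun _ hq => (hz.sqrt_coeffE_pos hq).ne').smul
    (EightFunctions.contDiffOn_partial hD hz.smooth (1, 0))

theorem IsSurface.contDiffOn_unitY (hz : IsSurface z D) (hD : IsOpen D) :
    ContDiffOn ℝ ∞ (unitY z) D :=
  (contDiffOn_const.div (hz.contDiffOn_sqrt_coeffG hD) fun _ hq => (hz.sqrt_coeffG_pos hq).ne').smul
    (EightFunctions.contDiffOn_partial hD hz.smooth (0, 1))

theorem IsSurface.partialU_eq (hz : IsSurface z D) (hq : q ∈ D) :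
    partialU z q = Real.sqrt (coeffE z q) • unitX z q := by
  rw [unitX, smul_smul, mul_one_div_cancel (hz.sqrt_coeffE_pos hq).ne', one_smul]

theorem IsSurface.partialV_eq (hz : IsSurface z D) (hq : q ∈ D) :
    partialV z q = Real.sqrt (coeffG z q) • unitY z q := by
  rw [unitY, smul_smul, mul_one_div_cancel (hz.sqrt_coeffG_pos hq).ne', one_smul]

/-- The functions `γ₁`, `γ₂` determine the derivatives of `√E`, `√G`. -/
theorem EightFunctions.AreGeometricFunctions.partialV_sqrt_coeffE
    (hf : f.AreGeometricFunctions z D b l) (hz : IsSurface z D) (hD : IsOpen D) (hq : q ∈ D) :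
    partialV (fun p => Real.sqrt (coeffE z p)) q =
      -f.γ₁ q * Real.sqrt (coeffE z q) * Real.sqrt (coeffG z q) := by
  have h := hf.γ₁ q hq
  have he := (hz.sqrt_coeffE_pos hq).ne'
  have hg := (hz.sqrt_coeffG_pos hq).ne'
  have hd := ((hz.contDiffOn_sqrt_coeffE hD).contDiffAt (hD.mem_nhds hq)).differentiableAt (by simp)
  rw [fderiv.log hd he, dirY_eq, map_smul] at h
  simp only [smul_apply, smul_eq_mul] at h
  rw [h, partialV]
  field_simp

theorem EightFunctions.AreGeometricFunctions.partialU_sqrt_coeffG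
    (hf : f.AreGeometricFunctions z D b l) (hz : IsSurface z D) (hD : IsOpen D) (hq : q ∈ D) :
    partialU (fun p => Real.sqrt (coeffG z p)) q =
      -f.γ₂ q * Real.sqrt (coeffE z q) * Real.sqrt (coeffG z q) := by
  have h := hf.γ₂ q hq
  have he := (hz.sqrt_coeffE_pos hq).ne'
  have hg := (hz.sqrt_coeffG_pos hq).ne'
  have hd := ((hz.contDiffOn_sqrt_coeffG hD).contDiffAt (hD.mem_nhds hq)).differentiableAt (by simp)
  rw [fderiv.log hd hg, dirX_eq, map_smul] at h
  simp only [smul_apply, smul_eq_mul] at h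
  rw [h, partialU]
  field_simp

/-- Each vector equation is checked against the frame. Products with `b` and `l` come from σ and
from β₁, β₂; the products of x and y with each other's derivatives come from z_uv = z_vu and the
formulas for γ₁, γ₂; the others follow by differentiating the orthonormality relations. -/
theorem structureEquations_of_isGeometricFrame (hD : IsOpen D) (hz : IsSurface z D)
    (hb : IsGeometricFrame o z D b l) (hf : f.AreGeometricFunctions z D b l) (hq : q ∈ D) :
    StructureEquations f (Real.sqrt (coeffE z q)) (Real.sqrt (coeffG z q)) (unitX z) (unitY z) b l
      q := by
  have d : ∀ {F : Type} [NormedAddCommGroup F] [NormedSpace ℝ F] {g : ℝ × ℝ → F},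
      ContDiffOn ℝ ∞ g D → DifferentiableAt ℝ g q := fun hg =>
    (hg.contDiffAt (hD.mem_nhds hq)).differentiableAt (by simp)
  have hdx := d (hz.contDiffOn_unitX hD)
  have hdy := d (hz.contDiffOn_unitY hD)
  have hdb := d hb.smooth_b
  have hdl := d hb.smooth_l
  have hde := d (hz.contDiffOn_sqrt_coeffE hD)
  have hdg := d (hz.contDiffOn_sqrt_coeffG hD)
  have he := hz.sqrt_coeffE_pos hq
  have hg := hz.sqrt_coeffG_pos hq
  have ho := fun p hp => orthonormal_four_iff.1 (hb.orthonormal p hp)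
  obtain ⟨⟨hxx, hyy, hbb, hll⟩, hxy, hxb, hxl, hyb, hyl, hbl⟩ := ho q hq
  have hEv := hf.partialV_sqrt_coeffE hz hD hq
  have hGu := hf.partialU_sqrt_coeffG hz hD hq
  have hbN : b q ∈ (tangentPlane z q)ᗮ := by
    rw [mem_tangentPlane_orthogonal, hz.partialU_eq hq, hz.partialV_eq hq]
    simp [inner_smul_left, hxb, hyb]
  have hlN : l q ∈ (tangentPlane z q)ᗮ := by
    rw [mem_tangentPlane_orthogonal, hz.partialU_eq hq, hz.partialV_eq hq]
    simp [inner_smul_left, hxl, hyl]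
  -- second derivatives of `z`
  have dU : ∀ X, fderiv ℝ (fun p => fderiv ℝ z p (1, 0)) q X =
      Real.sqrt (coeffE z q) • fderiv ℝ (unitX z) q X +
        fderiv ℝ (fun p => Real.sqrt (coeffE z p)) q X • unitX z q := by
    intro X
    rw [← fderiv_smul_dir hde hdx]
    exact congrArg (fun T => T X) (fderiv_congr_of_isOpen hD hq fun p hp => hz.partialU_eq hp)
  have dV : ∀ X, fderiv ℝ (fun p => fderiv ℝ z p (0, 1)) q X =
      Real.sqrt (coeffG z q) • fderiv ℝ (unitY z) q X +
        fderiv ℝ (fun p => Real.sqrt (coeffG z p)) q X • unitY z q := by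
    intro X
    rw [← fderiv_smul_dir hdg hdy]
    exact congrArg (fun T => T X) (fderiv_congr_of_isOpen hD hq fun p hp => hz.partialV_eq hp)
  have hcomm := fderiv_fderiv_comm hD hq hz.smooth (1, 0) (0, 1)
  have sxx := hf.sigma_xx q hq
  have sxy := hf.sigma_xy q hq
  have syy := hf.sigma_yy q hq
  rw [dirX_eq, sigma_smul hD hq hz.smooth] at sxx
  rw [dirX_eq, dirY_eq, sigma_smul hD hq hz.smooth] at sxy
  rw [dirY_eq, sigma_smul hD hq hz.smooth] at syy
  have hβ₁ := hf.β₁ q hq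
  have hβ₂ := hf.β₂ q hq
  rw [dirX_eq, map_smul, inner_smul_left] at hβ₁
  rw [dirY_eq, map_smul, inner_smul_left] at hβ₂
  have hbl' := (real_inner_comm (b q) (l q)).trans hbl
  have xxb := congrArg (inner ℝ (b q)) sxx
  have xxl := congrArg (inner ℝ (l q)) sxx
  have xyb := congrArg (inner ℝ (b q)) sxy
  have xyl := congrArg (inner ℝ (l q)) sxy
  have yyb := congrArg (inner ℝ (b q)) syy
  have yyl := congrArg (inner ℝ (l q)) syy
  -- σ(x, y) is used twice: z_vu gives the normal part of y_u and z_uv that of x_v.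
  have xyb' := xyb
  have xyl' := xyl
  rw [inner_smul_right, inner_sigma hbN] at xxb xyb yyb xyb'
  rw [inner_smul_right, inner_sigma hlN] at xxl xyl yyl xyl'
  rw [dU] at xxb xxl
  rw [dV] at xyb xyl yyb yyl
  rw [hcomm, dU] at xyb' xyl'
  have ip := fun {v w : ℝ × ℝ → R4} {c : ℝ} (hv : DifferentiableAt ℝ v q)
    (hw : DifferentiableAt ℝ w q) h => inner_fderiv_add_of_const (c := c) hD hq hv hw h
  have oxx := ip hdx hdx fun p hp => (ho p hp).1.1
  have oyy := ip hdy hdy fun p hp => (ho p hp).1.2.1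
  have obb := ip hdb hdb fun p hp => (ho p hp).1.2.2.1
  have oll := ip hdl hdl fun p hp => (ho p hp).1.2.2.2
  have oxy := ip hdx hdy fun p hp => (ho p hp).2.1
  have oxb := ip hdx hdb fun p hp => (ho p hp).2.2.1
  have oxl := ip hdx hdl fun p hp => (ho p hp).2.2.2.1
  have oyb := ip hdy hdb fun p hp => (ho p hp).2.2.2.2.1
  have oyl := ip hdy hdl fun p hp => (ho p hp).2.2.2.2.2.1
  have obl := ip hdb hdl fun p hp => (ho p hp).2.2.2.2.2.2
  have cyx := (real_inner_comm (unitX z q) (unitY z q)).trans hxy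
  have cbx := (real_inner_comm (unitX z q) (b q)).trans hxb
  have clx := (real_inner_comm (unitX z q) (l q)).trans hxl
  have cby := (real_inner_comm (unitY z q) (b q)).trans hyb
  have cly := (real_inner_comm (unitY z q) (l q)).trans hyl
  -- The tangential part of z_uv = z_vu expresses the products of x with y_u and of y with x_v
  -- through the derivatives of the lengths, that is, through γ₁ and γ₂.
  rw [dU, dV] at hcomm
  have tx := congrArg (inner ℝ (unitX z q)) hcomm
  have ty := congrArg (inner ℝ (unitY z q)) hcomm
  rw [real_inner_comm] at hβ₁ hβ₂
  simp only [partialU] at hGu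
  simp only [partialV] at hEv
  generalize Real.sqrt (coeffE z q) = e at *
  generalize Real.sqrt (coeffG z q) = g at *
  simp only [inner_add_right, inner_smul_right, hxx, hyy, hbb, hll, hxy, hbl,
    hbl', cyx, cbx, clx, cby, cly, mul_zero, mul_one, add_zero, zero_add, hGu, hEv,
    RCLike.conj_to_real] at xxb xxl xyb xyl xyb' xyl' yyb yyl tx ty hβ₁ hβ₂
  have he' := he.ne'
  have hg' := hg.ne'
  field_simp at xxb xxl xyb xyl xyb' xyl' yyb yyl hβ₁ hβ₂
  have zx := fun X => self_eq_neg.1 (eq_neg_of_add_eq_zero_left (oxx X))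
  have zy := fun X => self_eq_neg.1 (eq_neg_of_add_eq_zero_left (oyy X))
  have zb := fun X => self_eq_neg.1 (eq_neg_of_add_eq_zero_left (obb X))
  have zl := fun X => self_eq_neg.1 (eq_neg_of_add_eq_zero_left (oll X))
  rw [zx, mul_zero, zero_add] at tx
  rw [zy, mul_zero, zero_add] at ty
  have tx' : inner ℝ (unitX z q) (fderiv ℝ (unitY z) q (1, 0)) = -f.γ₁ q * e := by
    apply mul_left_cancel₀ hg'
    linear_combination tx
  have ty' : inner ℝ (unitY z q) (fderiv ℝ (unitX z) q (0, 1)) = -f.γ₂ q * g := by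
    apply mul_left_cancel₀ he'
    linear_combination -ty
  have r1 := oxy (1, 0)
  have r2 := oxy (0, 1)
  have r3 := oxb (1, 0)
  have r4 := oxb (0, 1)
  have r5 := oxl (1, 0)
  have r6 := oxl (0, 1)
  have r7 := oyb (1, 0)
  have r8 := oyb (0, 1)
  have r9 := oyl (1, 0)
  have r10 := oyl (0, 1)
  have r11 := obl (1, 0)
  have r12 := obl (0, 1)
  constructor <;> refine ext_inner_frame (hb.orthonormal q hq) ?_ ?_ ?_ ?_ <;>
    simp only [partialU, partialV, inner_add_right, inner_sub_right, inner_smul_right, hxx, hyy,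
      hbb, hll, hxy, hxb, hxl, hyb, hyl, hbl, hbl', cyx, cbx, clx, cby, cly, zx, zy, zb, zl,
      mul_zero, mul_one, add_zero, zero_add, sub_zero, zero_sub] <;> linarith

/-- The quotients `√E`, `√G` of the geometric functions are the lengths of `z_u`, `z_v`. -/
theorem sqrt_coeff_eq (hD : IsOpen D) (hz : IsSurface z D)
    (hb : IsGeometricFrame o z D b l) (hf : f.AreGeometricFunctions z D b l) (hfs : f.Smooth D)
    (hi : f.Inequalities D) (hq : q ∈ D) :
    Real.sqrt (coeffE z q) = f.sqrtE q ∧ Real.sqrt (coeffG z q) = f.sqrtG q := by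
  have d : ∀ {F : Type} [NormedAddCommGroup F] [NormedSpace ℝ F] {g : ℝ × ℝ → F},
      ContDiffOn ℝ ∞ g D → DifferentiableAt ℝ g q := fun hg =>
    (hg.contDiffAt (hD.mem_nhds hq)).differentiableAt (by simp)
  have hdl := d hb.smooth_l
  have hde := d (hz.contDiffOn_sqrt_coeffE hD)
  have hdg := d (hz.contDiffOn_sqrt_coeffG hD)
  have hdμ := d hfs.μ
  have hS := fun p hp => structureEquations_of_isGeometricFrame hD hz hb hf (q := p) hp
  have ho := fun p hp => orthonormal_four_iff.1 (hb.orthonormal p hp)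
  have hp : ∀ {v : ℝ × ℝ → R4}, ContDiffOn ℝ ∞ v D → ∀ X : ℝ × ℝ,
      DifferentiableAt ℝ (fun p => fderiv ℝ v p X) q := fun hv X =>
    d (EightFunctions.contDiffOn_partial hD hv X)
  have hEv := hf.partialV_sqrt_coeffE hz hD hq
  have hGu := hf.partialU_sqrt_coeffG hz hD hq
  have he := hz.sqrt_coeffE_pos hq
  have hg := hz.sqrt_coeffG_pos hq
  have hsx := hz.contDiffOn_unitX hD
  have hsy := hz.contDiffOn_unitY hD
  obtain ⟨⟨hxx, hyy, hbb, hll⟩, hxy, hxb, hxl, hyb, hyl, hbl⟩ := ho q hq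
  have cyx := (real_inner_comm (unitX z q) (unitY z q)).trans hxy
  have cbx := (real_inner_comm (unitX z q) (b q)).trans hxb
  have clx := (real_inner_comm (unitX z q) (l q)).trans hxl
  have cby := (real_inner_comm (unitY z q) (b q)).trans hyb
  have cly := (real_inner_comm (unitY z q) (l q)).trans hyl
  have clb := (real_inner_comm (b q) (l q)).trans hbl
  -- products of the mixed derivatives of `x`, `y` with `l`
  have key : ∀ {v : ℝ × ℝ → R4} {s t : ℝ × ℝ → ℝ} (hv : ContDiffOn ℝ ∞ v D)
      (X Y : ℝ × ℝ) (hs : DifferentiableAt ℝ s q) (ht : DifferentiableAt ℝ t q)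
      (h1 : ∀ p ∈ D, inner ℝ (fderiv ℝ v p X) (l p) = s p * t p)
      (h2 : ∀ p ∈ D, inner ℝ (fderiv ℝ v p Y) (l p) = 0),
      s q * fderiv ℝ t q Y + fderiv ℝ s q Y * t q =
        inner ℝ (fderiv ℝ v q X) (fderiv ℝ l q Y) - inner ℝ (fderiv ℝ v q Y) (fderiv ℝ l q X) := by
    intro v s t hv X Y hs ht h1 h2
    have e1 := fderiv_inner_apply ℝ (hp hv X) hdl Y
    have e2 := fderiv_inner_apply ℝ (hp hv Y) hdl X
    rw [fderiv_congr_of_isOpen hD hq h1, fderiv_fun_mul hs ht] at e1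
    rw [fderiv_congr_of_isOpen hD hq h2, fderiv_fderiv_comm hD hq hv] at e2
    simp only [add_apply, smul_apply, smul_eq_mul, fderiv_fun_const, Pi.zero_apply,
      zero_apply] at e1 e2
    linarith
  -- The `l`-component of x_uv = x_vu for the actual surface: ⟨x_v, l⟩ is |z_v| μ and ⟨x_u, l⟩
  -- vanishes. The next identity is its counterpart for y.
  have k1 := key hsx (0, 1) (1, 0) hdg hdμ
    (fun p hp => by
      obtain ⟨⟨hxx, hyy, hbb, hll⟩, hxy, hxb, hxl, hyb, hyl, hbl⟩ := ho p hp
      have := (hS p hp).x_v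
      rw [partialV] at this
      simp [this, inner_add_left, inner_smul_left, hyl, hbl, hll,
        -inner_self_eq_norm_sq_to_K])
    (fun p hp => by
      obtain ⟨⟨hxx, hyy, hbb, hll⟩, hxy, hxb, hxl, hyb, hyl, hbl⟩ := ho p hp
      have := (hS p hp).x_u
      rw [partialU] at this
      simp [this, inner_add_left, inner_smul_left, hyl, hbl])
  have k2 := key hsy (1, 0) (0, 1) hde hdμ
    (fun p hp => by
      obtain ⟨⟨hxx, hyy, hbb, hll⟩, hxy, hxb, hxl, hyb, hyl, hbl⟩ := ho p hp
      have := (hS p hp).y_u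
      rw [partialU] at this
      simp [this, inner_add_left, inner_smul_left, hxl, hbl, hll,
        -inner_self_eq_norm_sq_to_K])
    (fun p hp => by
      obtain ⟨⟨hxx, hyy, hbb, hll⟩, hxy, hxb, hxl, hyb, hyl, hbl⟩ := ho p hp
      have := (hS p hp).y_v
      rw [partialV] at this
      simp [this, inner_add_left, inner_smul_left, hxl, hbl])
  have hSq := hS q hq
  obtain ⟨xu, yu, -, lu, xv, yv, -, lv⟩ := hSq
  simp only [partialU] at xu yu lu hGu
  simp only [partialV] at xv yv lv hEv
  rw [hGu, xu, xv, lu, lv] at k1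
  rw [hEv, yu, yv, lu, lv] at k2
  generalize Real.sqrt (coeffE z q) = e at *
  generalize Real.sqrt (coeffG z q) = g at *
  simp only [inner_add_left, inner_sub_right, inner_smul_left, inner_smul_right, hxx, hyy, hbb,
    hxy, hxb, hyb, cyx, cbx, clx, cby, cly, clb, RCLike.conj_to_real, mul_zero, mul_one, add_zero,
    zero_add, zero_sub] at k1 k2
  -- Cancelling the other length leaves μ_u, respectively μ_v, as a length times the denominator of
  -- the quotient. Since the denominator does not vanish, this recovers the length.
  constructor
  · have h1 : partialU f.μ q =
        e * (2 * f.μ q * f.γ₂ q + f.ν₁ q * f.β₂ q - f.lam q * f.β₁ q) := by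
      apply mul_left_cancel₀ hg.ne'
      rw [partialU]
      linear_combination k1
    rw [EightFunctions.sqrtE, h1, mul_div_cancel_right₀ _ (hi.denU_ne_zero hq)]
  · have h1 : partialV f.μ q =
        g * (2 * f.μ q * f.γ₁ q - f.lam q * f.β₂ q + f.ν₂ q * f.β₁ q) := by
      apply mul_left_cancel₀ he.ne'
      rw [partialV]
      linear_combination k2
    rw [EightFunctions.sqrtG, h1, mul_div_cancel_right₀ _ (hi.denV_ne_zero hq)]

theorem hasFDerivAt_planeMap_pi {ι F : Type*} [Fintype ι] [NormedAddCommGroup F] [NormedSpace ℝ F]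
    {W : ℝ × ℝ → ι → F} {a c : ι → F} :
    HasFDerivAt W (planeMap a c) q ↔
      ∀ i, HasFDerivAt (fun p => W p i) (planeMap (a i) (c i)) q := by
  rw [hasFDerivAt_pi']
  refine forall_congr' fun i => ?_
  have : (ContinuousLinearMap.proj i).comp (planeMap a c) = planeMap (a i) (c i) := by
    ext <;> simp [planeMap_apply]
  rw [this]

/-- The frame together with the position vector. -/
def frameTuple (x y b l z : ℝ × ℝ → R4) (q : ℝ × ℝ) : Fin 5 → R4 :=
  ![x q, y q, b q, l q, z q]

/-- The frame of a surface with given geometric functions solves the linear system defined by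
these functions. -/
theorem hasFDerivAt_frameTuple (hD : IsOpen D) (hz : IsSurface z D)
    (hb : IsGeometricFrame o z D b l) (hf : f.AreGeometricFunctions z D b l) (hfs : f.Smooth D)
    (hi : f.Inequalities D) (hq : q ∈ D) :
    HasFDerivAt (frameTuple (unitX z) (unitY z) b l z)
      (planeMap
        (tupleActionL 5 R4 (f.frameMatrixU q) (frameTuple (unitX z) (unitY z) b l z q))
        (tupleActionL 5 R4 (f.frameMatrixV q) (frameTuple (unitX z) (unitY z) b l z q))) q := by
  have d : ∀ {F : Type} [NormedAddCommGroup F] [NormedSpace ℝ F] {g : ℝ × ℝ → F},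
      ContDiffOn ℝ ∞ g D → DifferentiableAt ℝ g q := fun hg =>
    (hg.contDiffAt (hD.mem_nhds hq)).differentiableAt (by simp)
  have hS := structureEquations_of_isGeometricFrame hD hz hb hf hq
  have zu := hz.partialU_eq hq
  have zv := hz.partialV_eq hq
  obtain ⟨hE, hG⟩ := sqrt_coeff_eq hD hz hb hf hfs hi hq
  rw [hE, hG] at hS
  rw [hE] at zu
  rw [hG] at zv
  rw [hasFDerivAt_planeMap_pi]
  intro i
  simp only [tupleActionL_apply, Fin.sum_univ_five]
  fin_cases i
  · refine hasFDerivAt_planeMap (d (hz.contDiffOn_unitX hD)) (hS.x_u.trans ?_) (hS.x_v.trans ?_) <;>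
      simp [EightFunctions.frameMatrixU, EightFunctions.frameMatrixV, frameTuple] <;> module
  · refine hasFDerivAt_planeMap (d (hz.contDiffOn_unitY hD)) (hS.y_u.trans ?_) (hS.y_v.trans ?_) <;>
      simp [EightFunctions.frameMatrixU, EightFunctions.frameMatrixV, frameTuple] <;> module
  · refine hasFDerivAt_planeMap (d hb.smooth_b) (hS.b_u.trans ?_) (hS.b_v.trans ?_) <;>
      simp [EightFunctions.frameMatrixU, EightFunctions.frameMatrixV, frameTuple] <;> module
  · refine hasFDerivAt_planeMap (d hb.smooth_l) (hS.l_u.trans ?_) (hS.l_v.trans ?_) <;>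
      simp [EightFunctions.frameMatrixU, EightFunctions.frameMatrixV, frameTuple] <;> module
  · refine hasFDerivAt_planeMap (d hz.smooth) (zu.trans ?_) (zv.trans ?_) <;>
      simp [EightFunctions.frameMatrixU, EightFunctions.frameMatrixV, frameTuple]

end

noncomputable section

/-! ### Preservation of orthonormality and orientation. -/

section OrthonormalFrames

/-- The matrix of coordinates of a frame. -/
def coordMatrix (w : Fin 4 → R4) : Matrix (Fin 4) (Fin 4) ℝ := Matrix.of fun i c => w i c

/-- A square matrix has orthonormal rows if and only if it has orthonormal columns. For C' = ΩC with
Ω skew, the column products CᵀC are constant outright, whereas the row products CCᵀ only satisfy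
another differential equation. -/
theorem orthonormal_iff_coordMatrix (w : Fin 4 → R4) :
    Orthonormal ℝ w ↔ (coordMatrix w).transpose * coordMatrix w = 1 := by
  rw [mul_eq_one_comm, orthonormal_iff_ite, ← Matrix.ext_iff]
  refine forall_congr' fun i => forall_congr' fun j => ?_
  simp [coordMatrix, Matrix.mul_apply, PiLp.inner_apply, Matrix.one_apply, mul_comm]

theorem abs_volumeForm_of_orthonormal (o : Orientation ℝ R4 (Fin 4)) {w : Fin 4 → R4}
    (h : Orthonormal ℝ w) : |o.volumeForm w| = 1 := by
  rw [o.abs_volumeForm_apply_of_pairwise_orthogonal fun i j hij => h.2 hij]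
  simp [h.1]

theorem continuous_volumeForm (o : Orientation ℝ R4 (Fin 4)) :
    Continuous fun w : Fin 4 → R4 => o.volumeForm w :=
  (AlternatingMap.mkContinuous o.volumeForm 1 fun w => by
    simpa using o.abs_volumeForm_apply_le w).cont

/-- An orthonormal frame field on a connected set which is positive at one point is positive. -/
theorem volumeForm_eq_one_of_isPreconnected (o : Orientation ℝ R4 (Fin 4)) {X : Type*}
    [TopologicalSpace X] {s : Set X} (hs : IsPreconnected s) {w : X → Fin 4 → R4}
    (hw : ContinuousOn w s) (h : ∀ q ∈ s, Orthonormal ℝ (w q)) {q₀ : X} (hq₀ : q₀ ∈ s)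
    (hpos : 0 < o.volumeForm (w q₀)) {q : X} (hq : q ∈ s) : o.volumeForm (w q) = 1 := by
  have habs := fun p hp => abs_volumeForm_of_orthonormal o (h p hp)
  rcases eq_or_eq_neg_of_abs_eq (habs q hq) with h1 | h1
  · exact h1
  -- A change from 1 to -1 would force the volume through zero, against its absolute value 1.
  · obtain ⟨p, hp, h0⟩ := hs.intermediate_value hq hq₀
      ((continuous_volumeForm o).comp_continuousOn hw)
      (show (0 : ℝ) ∈ Set.Icc _ _ from ⟨by simp [h1], hpos.le⟩)
    have := habs p hp
    simp only [Function.comp_apply] at h0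
    simp [h0] at this

/-- The volume form on combinations of the vectors of a positive orthonormal frame. -/
theorem volumeForm_frame (o : Orientation ℝ R4 (Fin 4)) {x y b l : R4}
    (h : Orthonormal ℝ ![x, y, b, l]) (h1 : o.volumeForm ![x, y, b, l] = 1)
    (e g a c a' c' : ℝ) :
    o.volumeForm ![e • x, g • y, a • b + c • l, a' • b + c' • l] =
      e * g * (a * c' - a' * c) := by
  have hc : Fintype.card (Fin 4) = Module.finrank ℝ R4 := by simp
  let B := basisOfOrthonormalOfCardEqFinrank h hc
  have hB : ⇑B = ![x, y, b, l] := coe_basisOfOrthonormalOfCardEqFinrank h hc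
  have e0 : x = B 0 := by simp [hB]
  have e1 : y = B 1 := by simp [hB]
  have e2 : b = B 2 := by simp [hB]
  have e3 : l = B 3 := by simp [hB]
  rw [AlternatingMap.eq_smul_basis_det B o.volumeForm, hB, h1, one_smul, Module.Basis.det_apply]
  have hM : B.toMatrix ![e • x, g • y, a • b + c • l, a' • b + c' • l] =
      !![e, 0, 0, 0; 0, g, 0, 0; 0, 0, a, a'; 0, 0, c, c'] := by
    ext i j
    rw [Module.Basis.toMatrix_apply, e0, e1, e2, e3]
    fin_cases j <;> fin_cases i <;> simp
  rw [hM]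
  simp [Matrix.det_succ_row_zero, Fin.sum_univ_succ]
  ring

end OrthonormalFrames

/-! ### From a solution of the linear system to a surface. -/

open Surface Metric

variable {o : Orientation ℝ R4 (Fin 4)} {f : EightFunctions} {D : Set (ℝ × ℝ)} {q : ℝ × ℝ}

theorem hasFDerivAt_coord {w : ℝ × ℝ → R4} {a c : R4} (hw : HasFDerivAt w (planeMap a c) q)
    (k : Fin 4) : HasFDerivAt (fun p => w p k) (planeMap (a k) (c k)) q := by
  have := (EuclideanSpace.proj (𝕜 := ℝ) k : R4 →L[ℝ] ℝ).hasFDerivAt.comp q hw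
  refine this.congr_fderiv ?_
  ext <;> simp [planeMap_apply]

/-- The components of a solution of the linear system satisfy the derivative formulas. -/
theorem structureEquations_of_hasFDerivAt {W : ℝ × ℝ → Fin 5 → R4}
    (hW : HasFDerivAt W (planeMap (tupleActionL 5 R4 (f.frameMatrixU q) (W q))
      (tupleActionL 5 R4 (f.frameMatrixV q) (W q))) q) :
    StructureEquations f (f.sqrtE q) (f.sqrtG q) (fun p => W p 0) (fun p => W p 1)
        (fun p => W p 2) (fun p => W p 3) q ∧
      partialU (fun p => W p 4) q = f.sqrtE q • W q 0 ∧
      partialV (fun p => W p 4) q = f.sqrtG q • W q 1 := by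
  rw [hasFDerivAt_planeMap_pi] at hW
  have hu := fun i => partialU_eq_of_hasFDerivAt (hW i)
  have hv := fun i => partialV_eq_of_hasFDerivAt (hW i)
  simp only [tupleActionL_apply, Fin.sum_univ_five] at hu hv
  refine ⟨⟨?_, ?_, ?_, ?_, ?_, ?_, ?_, ?_⟩, ?_, ?_⟩ <;>
    first
    | (rw [hu]; simp [EightFunctions.frameMatrixU]; done)
    | (rw [hv]; simp [EightFunctions.frameMatrixV]; done)
    | (rw [hu]; simp [EightFunctions.frameMatrixU]; module)
    | (rw [hv]; simp [EightFunctions.frameMatrixV]; module)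

/-- The products of the coordinates of a frame solving the linear system are constant. -/
theorem orthonormal_of_hasFDerivAt {W : ℝ × ℝ → Fin 5 → R4} (hD : IsOpen D)
    (hc : IsPreconnected D)
    (hW : ∀ q ∈ D, HasFDerivAt W (planeMap (tupleActionL 5 R4 (f.frameMatrixU q) (W q))
      (tupleActionL 5 R4 (f.frameMatrixV q) (W q))) q) {q₀ : ℝ × ℝ} (hq₀ : q₀ ∈ D)
    (h₀ : Orthonormal ℝ ![W q₀ 0, W q₀ 1, W q₀ 2, W q₀ 3]) (hq : q ∈ D) :
    Orthonormal ℝ ![W q 0, W q 1, W q 2, W q 3] := by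
  rw [orthonormal_iff_coordMatrix] at h₀ ⊢
  rw [← h₀]
  ext c d
  simp only [coordMatrix, Matrix.mul_apply, Matrix.transpose_apply, Matrix.of_apply,
    Fin.sum_univ_four]
  -- The derivative vanishes because the frame block is skew and the position does not enter the
  -- equations of the frame.
  have hder : ∀ p ∈ D, HasFDerivAt (fun p => W p 0 c * W p 0 d + W p 1 c * W p 1 d +
      W p 2 c * W p 2 d + W p 3 c * W p 3 d) (0 : ℝ × ℝ →L[ℝ] ℝ) p := by
    intro p hp
    have h1 := fun i k => hasFDerivAt_coord (hasFDerivAt_planeMap_pi.1 (hW p hp) i) k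
    refine (((((h1 0 c).mul (h1 0 d)).add ((h1 1 c).mul (h1 1 d))).add
      ((h1 2 c).mul (h1 2 d))).add ((h1 3 c).mul (h1 3 d))).congr_fderiv ?_
    ext <;> simp [planeMap_apply, tupleActionL_apply, Fin.sum_univ_five,
      EightFunctions.frameMatrixU, EightFunctions.frameMatrixV] <;> ring
  exact hD.is_const_of_fderiv_eq_zero hc
    (fun p hp => (hder p hp).differentiableAt.differentiableWithinAt)
    (fun p hp => (hder p hp).fderiv) hq hq₀

/-- A map `z` with a positively oriented orthonormal frame satisfying the derivative formulas. -/
structure IsFramedSurface (o : Orientation ℝ R4 (Fin 4)) (f : EightFunctions)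
    (z x y b l : ℝ × ℝ → R4) (D : Set (ℝ × ℝ)) : Prop where
  smooth_z : ContDiffOn ℝ ∞ z D
  smooth_x : ContDiffOn ℝ ∞ x D
  smooth_y : ContDiffOn ℝ ∞ y D
  smooth_b : ContDiffOn ℝ ∞ b D
  smooth_l : ContDiffOn ℝ ∞ l D
  orthonormal : ∀ q ∈ D, Orthonormal ℝ ![x q, y q, b q, l q]
  volume : ∀ q ∈ D, o.volumeForm ![x q, y q, b q, l q] = 1
  equations : ∀ q ∈ D, StructureEquations f (f.sqrtE q) (f.sqrtG q) x y b l q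
  z_u : ∀ q ∈ D, partialU z q = f.sqrtE q • x q
  z_v : ∀ q ∈ D, partialV z q = f.sqrtG q • y q

/-! ### Invariants of a framed surface. -/

namespace IsFramedSurface

variable {z x y b l : ℝ × ℝ → R4}

theorem coeffE_eq (h : IsFramedSurface o f z x y b l D) (hq : q ∈ D) :
    coeffE z q = f.sqrtE q ^ 2 := by
  obtain ⟨⟨hxx, hyy, hbb, hll⟩, hxy, hxb, hxl, hyb, hyl, hbl⟩ :=
    orthonormal_four_iff.1 (h.orthonormal q hq)
  rw [coeffE, h.z_u q hq, inner_smul_left, inner_smul_right, hxx]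
  simp [sq]

theorem coeffG_eq (h : IsFramedSurface o f z x y b l D) (hq : q ∈ D) :
    coeffG z q = f.sqrtG q ^ 2 := by
  obtain ⟨⟨hxx, hyy, hbb, hll⟩, hxy, hxb, hxl, hyb, hyl, hbl⟩ :=
    orthonormal_four_iff.1 (h.orthonormal q hq)
  rw [coeffG, h.z_v q hq, inner_smul_left, inner_smul_right, hyy]
  simp [sq]

theorem coeffF_eq (h : IsFramedSurface o f z x y b l D) (hq : q ∈ D) : coeffF z q = 0 := by
  obtain ⟨⟨hxx, hyy, hbb, hll⟩, hxy, hxb, hxl, hyb, hyl, hbl⟩ :=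
    orthonormal_four_iff.1 (h.orthonormal q hq)
  rw [coeffF, h.z_u q hq, h.z_v q hq, inner_smul_left, inner_smul_right, hxy]
  simp

theorem sqrt_coeffE (h : IsFramedSurface o f z x y b l D) (hi : f.Inequalities D) (hq : q ∈ D) :
    Real.sqrt (coeffE z q) = f.sqrtE q := by
  rw [h.coeffE_eq hq, Real.sqrt_sq (hi q hq).1.le]

theorem sqrt_coeffG (h : IsFramedSurface o f z x y b l D) (hi : f.Inequalities D) (hq : q ∈ D) :
    Real.sqrt (coeffG z q) = f.sqrtG q := by
  rw [h.coeffG_eq hq, Real.sqrt_sq (hi q hq).2.le]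

theorem coeffW_eq (h : IsFramedSurface o f z x y b l D) (hi : f.Inequalities D) (hq : q ∈ D) :
    coeffW z q = f.sqrtE q * f.sqrtG q := by
  rw [coeffW, h.coeffE_eq hq, h.coeffG_eq hq, h.coeffF_eq hq, ← Real.sqrt_sq
    (mul_pos (hi q hq).1 (hi q hq).2).le]
  ring_nf

theorem unitX_eq (h : IsFramedSurface o f z x y b l D) (hi : f.Inequalities D) (hq : q ∈ D) :
    unitX z q = x q := by
  rw [unitX, h.sqrt_coeffE hi hq, h.z_u q hq, smul_smul, one_div_mul_cancel (hi q hq).1.ne',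
    one_smul]

theorem unitY_eq (h : IsFramedSurface o f z x y b l D) (hi : f.Inequalities D) (hq : q ∈ D) :
    unitY z q = y q := by
  rw [unitY, h.sqrt_coeffG hi hq, h.z_v q hq, smul_smul, one_div_mul_cancel (hi q hq).2.ne',
    one_smul]

theorem isSurface (h : IsFramedSurface o f z x y b l D) (hi : f.Inequalities D) :
    IsSurface z D := by
  refine ⟨h.smooth_z, fun q hq => ?_⟩
  obtain ⟨⟨hxx, hyy, hbb, hll⟩, hxy, hxb, hxl, hyb, hyl, hbl⟩ :=
    orthonormal_four_iff.1 (h.orthonormal q hq)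
  have hyx := (real_inner_comm (x q) (y q)).trans hxy
  rw [LinearIndependent.pair_iff, h.z_u q hq, h.z_v q hq]
  intro s t hst
  have h1 := congrArg (inner ℝ (x q)) hst
  have h2 := congrArg (inner ℝ (y q)) hst
  simp only [inner_add_right, inner_smul_right, inner_zero_right, hxx, hyy, hxy, hyx, mul_zero,
    mul_one, add_zero, zero_add, mul_eq_zero, (hi q hq).1.ne', (hi q hq).2.ne', or_false] at h1 h2
  exact ⟨h1, h2⟩

/-- The second fundamental tensor is the `b`, `l` part of the second derivative. -/
theorem sigma_eq (h : IsFramedSurface o f z x y b l D) (hi : f.Inequalities D) (hq : q ∈ D)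
    {X Y : ℝ × ℝ} {r s t w : ℝ}
    (hd : fderiv ℝ (fun p => fderiv ℝ z p Y) q X = r • x q + s • y q + (t • b q + w • l q)) :
    sigma z q X Y = t • b q + w • l q := by
  obtain ⟨⟨hxx, hyy, hbb, hll⟩, hxy, hxb, hxl, hyb, hyl, hbl⟩ :=
    orthonormal_four_iff.1 (h.orthonormal q hq)
  rw [sigma, hd]
  refine (Submodule.eq_starProjection_of_mem_orthogonal ?_ ?_)
  · rw [mem_tangentPlane_orthogonal, h.z_u q hq, h.z_v q hq]
    simp [inner_smul_left, inner_smul_right, inner_add_right, hxb, hxl, hyb, hyl]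
  · rw [add_sub_cancel_right]
    refine Submodule.le_orthogonal_orthogonal _ ?_
    rw [tangentPlane, Submodule.mem_span_pair, h.z_u q hq, h.z_v q hq]
    refine ⟨r / f.sqrtE q, s / f.sqrtG q, ?_⟩
    rw [smul_smul, smul_smul, div_mul_cancel₀ _ (hi q hq).1.ne', div_mul_cancel₀ _ (hi q hq).2.ne']

theorem fderiv_partialU (h : IsFramedSurface o f z x y b l D) (hD : IsOpen D) (hf : f.Smooth D)
    (hi : f.Inequalities D) (hq : q ∈ D) (X : ℝ × ℝ) :
    fderiv ℝ (fun p => fderiv ℝ z p (1, 0)) q X =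
      f.sqrtE q • fderiv ℝ x q X + fderiv ℝ f.sqrtE q X • x q := by
  rw [← fderiv_smul_dir (((hf.sqrtE hD hi).contDiffAt (hD.mem_nhds hq)).differentiableAt (by simp))
    ((h.smooth_x.contDiffAt (hD.mem_nhds hq)).differentiableAt (by simp))]
  exact congrArg (fun T => T X) (fderiv_congr_of_isOpen hD hq h.z_u)

theorem fderiv_partialV (h : IsFramedSurface o f z x y b l D) (hD : IsOpen D) (hf : f.Smooth D)
    (hi : f.Inequalities D) (hq : q ∈ D) (X : ℝ × ℝ) :
    fderiv ℝ (fun p => fderiv ℝ z p (0, 1)) q X =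
      f.sqrtG q • fderiv ℝ y q X + fderiv ℝ f.sqrtG q X • y q := by
  rw [← fderiv_smul_dir (((hf.sqrtG hD hi).contDiffAt (hD.mem_nhds hq)).differentiableAt (by simp))
    ((h.smooth_y.contDiffAt (hD.mem_nhds hq)).differentiableAt (by simp))]
  exact congrArg (fun T => T X) (fderiv_congr_of_isOpen hD hq h.z_v)

theorem sigma_uu (h : IsFramedSurface o f z x y b l D) (hD : IsOpen D) (hf : f.Smooth D)
    (hi : f.Inequalities D) (hq : q ∈ D) :
    sigma z q (1, 0) (1, 0) = (f.sqrtE q ^ 2 * f.ν₁ q) • b q + (0 : ℝ) • l q := by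
  refine h.sigma_eq hi hq (r := fderiv ℝ f.sqrtE q (1, 0)) (s := f.sqrtE q ^ 2 * f.γ₁ q) ?_
  have := (h.equations q hq).x_u
  rw [partialU] at this
  rw [h.fderiv_partialU hD hf hi hq, this]
  module

theorem sigma_uv (h : IsFramedSurface o f z x y b l D) (hD : IsOpen D) (hf : f.Smooth D)
    (hi : f.Inequalities D) (hq : q ∈ D) :
    sigma z q (1, 0) (0, 1) =
      (f.sqrtE q * f.sqrtG q * f.lam q) • b q + (f.sqrtE q * f.sqrtG q * f.μ q) • l q := by
  refine h.sigma_eq hi hq (r := -(f.sqrtE q * f.sqrtG q * f.γ₁ q))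
    (s := fderiv ℝ f.sqrtG q (1, 0)) ?_
  have := (h.equations q hq).y_u
  rw [partialU] at this
  rw [h.fderiv_partialV hD hf hi hq, this]
  module

theorem sigma_vv (h : IsFramedSurface o f z x y b l D) (hD : IsOpen D) (hf : f.Smooth D)
    (hi : f.Inequalities D) (hq : q ∈ D) :
    sigma z q (0, 1) (0, 1) = (f.sqrtG q ^ 2 * f.ν₂ q) • b q + (0 : ℝ) • l q := by
  refine h.sigma_eq hi hq (r := f.sqrtG q ^ 2 * f.γ₂ q) (s := fderiv ℝ f.sqrtG q (0, 1)) ?_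
  have := (h.equations q hq).y_v
  rw [partialV] at this
  rw [h.fderiv_partialV hD hf hi hq, this]
  module

theorem normalArea_eq (h : IsFramedSurface o f z x y b l D) (hi : f.Inequalities D) (hq : q ∈ D)
    (a c a' c' : ℝ) :
    normalArea o z q (a • b q + c • l q) (a' • b q + c' • l q) = a * c' - a' * c := by
  rw [normalArea, h.z_u q hq, h.z_v q hq, h.coeffW_eq hi hq,
    volumeForm_frame o (h.orthonormal q hq) (h.volume q hq),
    mul_div_cancel_left₀ _ (mul_pos (hi q hq).1 (hi q hq).2).ne']

/-- Since σ(z_u, z_u) is a multiple of `b`, only the `l`-part of σ(z_u, z_v), which carries μ,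
contributes to the area. -/
theorem coeffL_eq (h : IsFramedSurface o f z x y b l D) (hD : IsOpen D) (hf : f.Smooth D)
    (hi : f.Inequalities D) (hq : q ∈ D) :
    coeffL o z q = 2 * f.sqrtE q ^ 2 * f.ν₁ q * f.μ q := by
  have hE := (hi q hq).1.ne'
  have hG := (hi q hq).2.ne'
  rw [coeffL, h.sigma_uu hD hf hi hq, h.sigma_uv hD hf hi hq, h.normalArea_eq hi hq,
    h.coeffW_eq hi hq]
  field_simp
  ring

/-- Both σ(z_u, z_u) and σ(z_v, z_v) are multiples of `b`; this is why the parameter lines are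
principal. -/
theorem coeffM_eq (h : IsFramedSurface o f z x y b l D) (hD : IsOpen D) (hf : f.Smooth D)
    (hi : f.Inequalities D) (hq : q ∈ D) : coeffM o z q = 0 := by
  rw [coeffM, h.sigma_uu hD hf hi hq, h.sigma_vv hD hf hi hq, h.normalArea_eq hi hq]
  simp

theorem coeffN_eq (h : IsFramedSurface o f z x y b l D) (hD : IsOpen D) (hf : f.Smooth D)
    (hi : f.Inequalities D) (hq : q ∈ D) :
    coeffN o z q = -(2 * f.sqrtG q ^ 2 * f.ν₂ q * f.μ q) := by
  have hE := (hi q hq).1.ne'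
  have hG := (hi q hq).2.ne'
  rw [coeffN, h.sigma_vv hD hf hi hq, h.sigma_uv hD hf hi hq, h.normalArea_eq hi hq,
    h.coeffW_eq hi hq]
  field_simp
  ring

/-- Here ϰ = (ν₁ - ν₂)μ and k = -4ν₁ν₂μ², so the difference is μ²((ν₁ - ν₂)² + 4ν₁ν₂). -/
theorem invKappa_sq_sub_invK (h : IsFramedSurface o f z x y b l D) (hD : IsOpen D)
    (hf : f.Smooth D) (hi : f.Inequalities D) (hq : q ∈ D) :
    invKappa o z q ^ 2 - invK o z q = (f.μ q * (f.ν₁ q + f.ν₂ q)) ^ 2 := by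
  have hE := (hi q hq).1.ne'
  have hG := (hi q hq).2.ne'
  rw [invKappa, invK, h.coeffL_eq hD hf hi hq, h.coeffM_eq hD hf hi hq, h.coeffN_eq hD hf hi hq,
    h.coeffE_eq hq, h.coeffF_eq hq, h.coeffG_eq hq]
  field_simp
  ring

/-- The lengths of z_u and z_v are the two quotients, so the formulas for γ₁, γ₂ are the first two
compatibility equations. The remaining functions are coefficients of the derivative formulas. -/
theorem areGeometricFunctions (h : IsFramedSurface o f z x y b l D) (hD : IsOpen D)
    (hf : f.Smooth D) (hi : f.Inequalities D) (hc : f.Compatible D) :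
    f.AreGeometricFunctions z D b l := by
  have hcE : ∀ q ∈ D, fderiv ℝ (fun p => Real.log (Real.sqrt (coeffE z p))) q =
      (f.sqrtE q)⁻¹ • fderiv ℝ f.sqrtE q := fun q hq => by
    rw [fderiv_congr_of_isOpen hD hq (g := fun p => Real.log (f.sqrtE p))
      (fun p hp => by rw [h.sqrt_coeffE hi hp])]
    exact fderiv.log (((hf.sqrtE hD hi).contDiffAt (hD.mem_nhds hq)).differentiableAt (by simp))
      (hi q hq).1.ne'
  have hcG : ∀ q ∈ D, fderiv ℝ (fun p => Real.log (Real.sqrt (coeffG z p))) q =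
      (f.sqrtG q)⁻¹ • fderiv ℝ f.sqrtG q := fun q hq => by
    rw [fderiv_congr_of_isOpen hD hq (g := fun p => Real.log (f.sqrtG p))
      (fun p hp => by rw [h.sqrt_coeffG hi hp])]
    exact fderiv.log (((hf.sqrtG hD hi).contDiffAt (hD.mem_nhds hq)).differentiableAt (by simp))
      (hi q hq).2.ne'
  constructor <;> intro q hq <;> have hE := (hi q hq).1.ne' <;> have hG := (hi q hq).2.ne'
  · have e1 := hc.eq₁ q hq
    rw [partialV] at e1
    rw [hcE q hq, dirY_eq, h.sqrt_coeffG hi hq, map_smul, smul_apply, ← e1]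
    simp only [smul_eq_mul]
    field_simp
  · have e2 := hc.eq₂ q hq
    rw [partialU] at e2
    rw [hcG q hq, dirX_eq, h.sqrt_coeffE hi hq, map_smul, smul_apply, ← e2]
    simp only [smul_eq_mul]
    field_simp
  · rw [dirX_eq, sigma_smul hD hq h.smooth_z, h.sqrt_coeffE hi hq, h.sigma_uu hD hf hi hq,
      zero_smul, add_zero, smul_smul]
    congr 1
    field_simp
  · rw [dirX_eq, dirY_eq, sigma_smul hD hq h.smooth_z, h.sqrt_coeffE hi hq, h.sqrt_coeffG hi hq,
      h.sigma_uv hD hf hi hq, smul_add, smul_smul, smul_smul]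
    congr 2 <;> field_simp
  · rw [dirY_eq, sigma_smul hD hq h.smooth_z, h.sqrt_coeffG hi hq, h.sigma_vv hD hf hi hq,
      zero_smul, add_zero, smul_smul]
    congr 1
    field_simp
  · obtain ⟨⟨hxx, hyy, hbb, hll⟩, hxy, hxb, hxl, hyb, hyl, hbl⟩ :=
      orthonormal_four_iff.1 (h.orthonormal q hq)
    have hd := (h.equations q hq).b_u
    rw [partialU] at hd
    rw [dirX_eq, h.sqrt_coeffE hi hq, map_smul, hd, smul_smul, one_div_mul_cancel hE, one_smul]
    simp only [inner_add_left, inner_sub_left, inner_smul_left, hxl, hyl, hll]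
    simp
  · obtain ⟨⟨hxx, hyy, hbb, hll⟩, hxy, hxb, hxl, hyb, hyl, hbl⟩ :=
      orthonormal_four_iff.1 (h.orthonormal q hq)
    have hd := (h.equations q hq).b_v
    rw [partialV] at hd
    rw [dirY_eq, h.sqrt_coeffG hi hq, map_smul, hd, smul_smul, one_div_mul_cancel hG, one_smul]
    simp only [inner_add_left, inner_sub_left, inner_smul_left, hxl, hyl, hll]
    simp

theorem isGeometricFrame (h : IsFramedSurface o f z x y b l D) (hD : IsOpen D)
    (hf : f.Smooth D) (hi : f.Inequalities D) (hc : f.Compatible D) :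
    IsGeometricFrame o z D b l where
  smooth_b := h.smooth_b
  smooth_l := h.smooth_l
  orthonormal q hq := by rw [h.unitX_eq hi hq, h.unitY_eq hi hq]; exact h.orthonormal q hq
  positive q hq := by
    rw [h.unitX_eq hi hq, h.unitY_eq hi hq, h.volume q hq]; exact one_pos
  collinear_x q hq := by
    rw [(h.areGeometricFunctions hD hf hi hc).sigma_xx q hq]
    exact Submodule.smul_mem _ _ (Submodule.mem_span_singleton_self _)
  collinear_y q hq := by
    rw [(h.areGeometricFunctions hD hf hi hc).sigma_yy q hq]
    exact Submodule.smul_mem _ _ (Submodule.mem_span_singleton_self _)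

theorem isBonnetSurface (h : IsFramedSurface o f z x y b l D) (hD : IsOpen D)
    (hf : f.Smooth D) (hi : f.Inequalities D) (hc : f.Compatible D) (hq : q ∈ D) :
    IsBonnetSurface o f D q (z q) (x q) (y q) (b q) (l q) z :=
  ⟨h.isSurface hi, fun _ hp => ⟨h.coeffF_eq hp, h.coeffM_eq hD hf hi hp⟩, rfl, b, l,
    h.isGeometricFrame hD hf hi hc, h.areGeometricFunctions hD hf hi hc, h.unitX_eq hi hq,
    h.unitY_eq hi hq, rfl, rfl⟩

end IsFramedSurface

theorem EightFunctions.Smooth.mono {D' : Set (ℝ × ℝ)} (h : f.Smooth D) (hs : D' ⊆ D) :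
    f.Smooth D' :=
  ⟨h.γ₁.mono hs, h.γ₂.mono hs, h.ν₁.mono hs, h.ν₂.mono hs, h.lam.mono hs, h.μ.mono hs,
    h.β₁.mono hs, h.β₂.mono hs⟩

theorem EightFunctions.Compatible.mono {D' : Set (ℝ × ℝ)} (h : f.Compatible D) (hs : D' ⊆ D) :
    f.Compatible D' :=
  ⟨fun q hq => h.eq₁ q (hs hq), fun q hq => h.eq₂ q (hs hq), fun q hq => h.eq₃ q (hs hq),
    fun q hq => h.eq₄ q (hs hq), fun q hq => h.eq₅ q (hs hq), fun q hq => h.eq₆ q (hs hq)⟩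

/-- A solution of the linear system with a positive orthonormal initial frame is a framed
surface. -/
theorem isFramedSurface_of_hasFDerivAt {W : ℝ × ℝ → Fin 5 → R4} (hD : IsOpen D)
    (hc : IsPreconnected D) (hWs : ContDiffOn ℝ ∞ W D)
    (hW : ∀ q ∈ D, HasFDerivAt W (planeMap (tupleActionL 5 R4 (f.frameMatrixU q) (W q))
      (tupleActionL 5 R4 (f.frameMatrixV q) (W q))) q) {q₀ : ℝ × ℝ} (hq₀ : q₀ ∈ D)
    (h₀ : Orthonormal ℝ ![W q₀ 0, W q₀ 1, W q₀ 2, W q₀ 3])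
    (hpos : 0 < o.volumeForm ![W q₀ 0, W q₀ 1, W q₀ 2, W q₀ 3]) :
    IsFramedSurface o f (fun q => W q 4) (fun q => W q 0) (fun q => W q 1) (fun q => W q 2)
      (fun q => W q 3) D := by
  have hs := contDiffOn_pi.1 hWs
  have horth := fun p hp => orthonormal_of_hasFDerivAt hD hc hW hq₀ h₀ (q := p) hp
  refine ⟨hs 4, hs 0, hs 1, hs 2, hs 3, horth, fun q hq => ?_,
    fun q hq => (structureEquations_of_hasFDerivAt (hW q hq)).1,
    fun q hq => (structureEquations_of_hasFDerivAt (hW q hq)).2.1,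
    fun q hq => (structureEquations_of_hasFDerivAt (hW q hq)).2.2⟩
  refine volumeForm_eq_one_of_isPreconnected o hc
    (w := fun q => ![W q 0, W q 1, W q 2, W q 3]) ?_ horth hq₀ hpos hq
  refine continuousOn_pi.2 fun i => ?_
  fin_cases i
  · exact (hs 0).continuousOn
  · exact (hs 1).continuousOn
  · exact (hs 2).continuousOn
  · exact (hs 3).continuousOn

end

/-! ### The existence and uniqueness theorem. -/

theorem theorem4p1 (o : Orientation ℝ R4 (Fin 4))
    (D : Set (ℝ × ℝ)) (hD : IsPlaneDomain D)
    (f : EightFunctions) (hf : f.Smooth D) (hineq : f.Inequalities D) (hcomp : f.Compatible D)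
    (q₀ : ℝ × ℝ) (hq₀ : q₀ ∈ D)
    (p₀ x₀ y₀ b₀ l₀ : R4) (horth : Orthonormal ℝ ![x₀, y₀, b₀, l₀])
    (hpos : 0 < o.volumeForm ![x₀, y₀, b₀, l₀]) :
    ∃ D₀ : Set (ℝ × ℝ), D₀ ⊆ D ∧ IsPlaneDomain D₀ ∧ q₀ ∈ D₀ ∧
      ∃ z : ℝ × ℝ → R4,
        IsBonnetSurface o f D₀ q₀ p₀ x₀ y₀ b₀ l₀ z ∧
        (∀ z' : ℝ × ℝ → R4,
          IsBonnetSurface o f D₀ q₀ p₀ x₀ y₀ b₀ l₀ z' → Set.EqOn z' z D₀) ∧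
        (∀ q ∈ D₀, Real.sqrt (Surface.coeffE z q) = f.sqrtE q ∧
          Real.sqrt (Surface.coeffG z q) = f.sqrtG q) ∧
        (∀ q ∈ D₀, 0 < Surface.invKappa o z q ^ 2 - Surface.invK o z q ↔
          f.μ q ≠ 0 ∧ f.ν₁ q + f.ν₂ q ≠ 0) := by
  have hU := hf.frameMatrixU hD.1 hineq
  have hV := hf.frameMatrixV hD.1 hineq
  have hA := (tupleActionL 5 R4).contDiff.comp_contDiffOn hU
  have hB := (tupleActionL 5 R4).contDiff.comp_contDiffOn hV
  obtain ⟨R, hR, hsub, W, hW₀, hWs, hW⟩ := exists_solution_of_flat hD.1 hA hB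
    (fun q hq w => tupleActionL_flat
      ((hU.contDiffAt (hD.1.mem_nhds hq)).differentiableAt (by simp))
      ((hV.contDiffAt (hD.1.mem_nhds hq)).differentiableAt (by simp))
      (hcomp.flat hf hD.1 hineq hq) w) hq₀ ![x₀, y₀, b₀, l₀, p₀]
  have hi : f.Inequalities (Metric.ball q₀ R) := fun q hq => hineq q (hsub hq)
  have hfs := hf.mono hsub
  have hc := hcomp.mono hsub
  have hopen : IsOpen (Metric.ball q₀ R) := Metric.isOpen_ball
  have hconn : IsConnected (Metric.ball q₀ R) :=
    (convex_ball q₀ R).isConnected (Metric.nonempty_ball.2 hR)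
  have hmem := Metric.mem_ball_self (x := q₀) hR
  have hS := isFramedSurface_of_hasFDerivAt (o := o) hopen hconn.isPreconnected hWs hW hmem
    (by simpa [hW₀] using horth) (by simpa [hW₀] using hpos)
  -- A ball is connected, as the orthonormality and orientation arguments require, and contains all
  -- segments from q₀, along which uniqueness is proved.
  refine ⟨Metric.ball q₀ R, hsub, ⟨hopen, hconn⟩, hmem, fun q => W q 4, ?_, ?_, ?_, ?_⟩
  · simpa [hW₀] using hS.isBonnetSurface hopen hfs hi hc hmem
  · rintro z' ⟨hz, -, hz₀, b, l, hb, hgf, hx₀, hy₀, hb₀, hl₀⟩ q hq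
    -- The frame and position of z' solve the same linear system as `W` and agree with it at q₀. The
    -- last component of the tuple is the position.
    have := eqOn_ball_of_hasFDerivAt_planeMap (hA.mono hsub) (hB.mono hsub)
      (fun q hq => hasFDerivAt_frameTuple hopen hz hb hgf hfs hi hq) hW
      (by simp [frameTuple, hW₀, hz₀, hx₀, hy₀, hb₀, hl₀]) hq
    exact congrFun this 4
  · exact fun q hq => ⟨hS.sqrt_coeffE hi hq, hS.sqrt_coeffG hi hq⟩
  · intro q hq
    rw [hS.invKappa_sq_sub_invK hopen hfs hi hq, sq_pos_iff, mul_ne_zero_iff]
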